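/- **Setting.** Let $(M,g)$ be a smooth 4-dimensional Lorentzian manifold of signature $(-,+,+,+)$ with Levi-Civita connection $\nabla$. A *double null coordinate system* is a smooth chart $(s,\underline s,\theta^1,\theta^2)$ on an open subset of $M$ such that - $g(\nabla s,\nabla s)=g(\nabla\underline s,\nabla\underline s)=0$, and, with $L'=2\nabla s$ and $\underline L'=2\nabla\underline s$, $g(L',\underline L')>0$ (which holds when $\underline s$ increases and $s$ decreases towards the future); - with $\Omega>0$ defined by $2\Omega^{-2}=g(L',\underline L')$, $L=\Omega^2L'$, $\underline L=\Omega^2\underline L'$, the functions $\theta^1,\theta^2$ are constant along the integral curves of $L$, and, on $\{\underline s=0\}$, along those of $\underline L$. Let $C_{s_0}=\{s=s_0\}$, and let $\partial_i=\partial_{\theta^i}$, $i=1,2$, be the angular coordinate fields. Let $\not g_{ij}=g(\partial_i,\partial_j)$ be the induced metric on the surfaces $\Sigma_{s,\underline s}$ on which $s$ and $\underline s$ are constant, $\not\Gamma^k_{ij}$ its Christoffel symbols on these surfaces, and put $$\chi_{ij}=g(\nabla_{\partial_i}L,\partial_j),\quad \underline\chi_{ij}=g(\nabla_{\partial_i}\underline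 L,\partial_j),\quad \eta_i=\tfrac12g(\nabla_{\partial_i}\underline L,L'),\quad \underline\eta_i=\tfrac12g(\nabla_{\partial_i}L,\underline L'),\quad \omega=L\log\Omega .$$ For a spacelike surface $\Sigma$ of class $C^2$ parametrised by $\vartheta\mapsto(s,\underline s,\vartheta)=(f(\vartheta),\underline f(\vartheta),\vartheta)$, with $\vartheta$ in an open subset of $\mathbb R^2$, write $f_i=\partial_if$, $\underline f_i=\partial_i\underline f$, let $\dot\partial_i=\partial_i+f_i\partial_s+\underline f_i\partial_{\underline s}$ be the tangential coordinate frame and $\dot{\not g}_{ij}=g(\dot\partial_i,\dot\partial_j)$ the intrinsic metric. With $\vec b=b^i\partial_i=\underline L-\partial_s$, $B_i^j=\delta_i^j-f_ib^j$, and $$e^k=-2\Omega^2f_i(B^{-1})^i_j(\not g^{-1})^{jk},\quad \underline e^k=-2\Omega^2\underline f_i(B^{-1})^i_j(\not g^{-1})^{jk},\quad D=(2\Omega^2+e\cdot\underline e)+\sqrt{(2\Omega^2+e\cdot\underline e)^2-|e|^2|\underline e|^2},$$ $$\varepsilon=-|e|^2/D,\qquad \underline\varepsilon=-|\underline e|^2/D,\qquad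 \varepsilon^k=e^k+\varepsilon\,\underline e^k,\qquad \underline\varepsilon^k=\underline e^k+\underline\varepsilon\, e^k$$ (products and norms with respect to $\not g$), the null normal frame of $\Sigma$ is $$\dot L=L+\varepsilon\underline L+\varepsilon^k\partial_k,\qquad \dot{\underline L}=\underline L+\underline\varepsilon L+\underline\varepsilon^k\partial_k .$$ Let $\dot\Omega>0$ be given by $2\dot\Omega^2=g(\dot{\underline L},\dot L)$, put $\dot L'=\dot\Omega^{-2}\dot L$, and define the structure coefficients of $\Sigma$ by $$\dot\chi_{ij}=g(\nabla_{\dot\partial_i}\dot L,\dot\partial_j),\qquad \dot{\underline\chi}_{ij}=g(\nabla_{\dot\partial_i}\dot{\underline L},\dot\partial_j),\qquad \dot\eta_i=\tfrac12g(\nabla_{\dot\partial_i}\dot{\underline L},\dot L').$$ **Proposition 4.2.** Let $\Sigma$ be a spacelike surface embedded in the null hypersurface $C_{s_0}$ and parametrised by $(s_0,\underline f)$, i.e. $f\equiv s_0$. Then, at every point of $\Sigma$, $$\dot{\underline\chi}_{ij}=\underline\chi_{ij}-\Omega^2|d\underline f|^2\chi_{ij}-2\Omega^2\not\nabla^2_{ij}\underline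 f-4\Omega^2\,\mathrm{sym}\{\underline\eta\otimes d\underline f\}_{ij}-4\omega\Omega^2\underline f_i\underline f_j+4\Omega^2\,\mathrm{sym}\{d\underline f\otimes\chi(\not\nabla\underline f)\}_{ij},$$ $$\dot{\mathrm{tr}}\,\dot{\underline\chi}=\mathrm{tr}\,\underline\chi-2\Omega^2\not\Delta\underline f-\Omega^2|d\underline f|^2\,\mathrm{tr}\,\chi-4\Omega^2\,\underline\eta\cdot d\underline f-4\Omega^2\omega|d\underline f|^2+4\Omega^2\chi(\not\nabla\underline f,\not\nabla\underline f),$$ $$\dot\chi_{ij}=\chi_{ij},\qquad \dot{\mathrm{tr}}\,\dot\chi=\mathrm{tr}\,\chi,\qquad \dot\eta_i=\eta_i+\chi(\not\nabla\underline f)_i .$$ Here $(d\underline f)_i=\underline f_i$, $\not\nabla^i\underline f=(\not g^{-1})^{ij}\underline f_j$, $\not\nabla^2_{ij}\underline f=\partial_i\partial_j\underline f-\not\Gamma^k_{ij}\underline f_k$ with $\not\Gamma^k_{ij}$ taken at the points of $\Sigma$, $\not\Delta\underline f=(\not g^{-1})^{ij}\not\nabla^2_{ij}\underline f$, $\chi(V)_i=\chi_{ij}V^j$,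 $\mathrm{sym}(P\otimes Q)_{ij}=\frac12(P_iQ_j+P_jQ_i)$; the norm $|d\underline f|$, the product $\cdot$ and $\mathrm{tr}$ are taken with respect to $\not g$, and $\dot{\mathrm{tr}}$ with respect to $\dot{\not g}$. -/

import Mathlib

open scoped Manifold ContDiff

namespace DoubleNull

noncomputable section

/-! ### Metrics in coordinates -/

/-- The `μ`-th partial derivative of a real function on `ℝⁿ`. -/
def pd {n : ℕ} (h : EuclideanSpace ℝ (Fin n) → ℝ) (μ : Fin n) (x : EuclideanSpace ℝ (Fin n)) : ℝ :=
  fderiv ℝ h x (EuclideanSpace.single μ 1)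

/-- Christoffel symbols `Γ^μ_{νρ}` of the Levi-Civita connection of a (pseudo-Riemannian) metric
with components `G`. -/
def christoffel {n : ℕ} (G : EuclideanSpace ℝ (Fin n) → Matrix (Fin n) (Fin n) ℝ)
    (μ ν ρ : Fin n) (x : EuclideanSpace ℝ (Fin n)) : ℝ :=
  (1 / 2) * ∑ σ, (G x)⁻¹ μ σ *
    (pd (fun y => G y σ ρ) ν x + pd (fun y => G y σ ν) ρ x - pd (fun y => G y ν ρ) σ x)

/-- The scalar product `∑ g_{μν} V^μ W^ν` for a matrix `g` of metric components. -/
def sprod {n : ℕ} (g : Matrix (Fin n) (Fin n) ℝ) (V W : Fin n → ℝ) : ℝ :=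
  ∑ μ, ∑ ν, g μ ν * V μ * W ν

/-! ### Lorentzian 4-manifolds -/

/-- The component `g(∂_μ, ∂_ν)`, in the coordinates given by the chart `φ` and at the point with
coordinates `x`, of a field of bilinear forms on the tangent spaces of `M`. -/
def chartComponent {M : Type*} [TopologicalSpace M] [ChartedSpace (EuclideanSpace ℝ (Fin 4)) M]
    (g : ∀ p : M, TangentSpace (𝓡 4) p →L[ℝ] TangentSpace (𝓡 4) p →L[ℝ] ℝ)
    (φ : OpenPartialHomeomorph M (EuclideanSpace ℝ (Fin 4)))
    (x : EuclideanSpace ℝ (Fin 4)) (μ ν : Fin 4) : ℝ :=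
  g (φ.symm x)
    (mfderiv (𝓡 4) (𝓡 4) φ.symm x (EuclideanSpace.single μ (1 : ℝ) : EuclideanSpace ℝ (Fin 4)))
    (mfderiv (𝓡 4) (𝓡 4) φ.symm x (EuclideanSpace.single ν (1 : ℝ) : EuclideanSpace ℝ (Fin 4)))

/-- A smooth Lorentzian metric, of signature `(-,+,+,+)`, on a smooth 4-manifold. -/
structure LorentzMetric (M : Type*) [TopologicalSpace M]
    [ChartedSpace (EuclideanSpace ℝ (Fin 4)) M] where
  /-- The bilinear form on each tangent space. -/
  val : ∀ p : M, TangentSpace (𝓡 4) p →L[ℝ] TangentSpace (𝓡 4) p →L[ℝ] ℝ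
  symm : ∀ (p : M) (v w : TangentSpace (𝓡 4) p), val p v w = val p w v
  signature : ∀ p : M, ∃ e : Module.Basis (Fin 4) ℝ (TangentSpace (𝓡 4) p), ∀ μ ν : Fin 4,
    val p (e μ) (e ν) = if μ = ν then (if μ = 0 then -1 else 1) else 0
  /-- The components in every chart of the smooth structure are smooth functions. -/
  smooth : ∀ φ ∈ IsManifold.maximalAtlas (𝓡 4) ∞ M, ∀ μ ν : Fin 4,
    ContDiffOn ℝ ∞ (fun x => chartComponent val φ x μ ν) φ.target

/-- The matrix of components `g_{μν}` of a Lorentzian metric in a chart. -/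
def LorentzMetric.inChart {M : Type*} [TopologicalSpace M]
    [ChartedSpace (EuclideanSpace ℝ (Fin 4)) M] (g : LorentzMetric M)
    (φ : OpenPartialHomeomorph M (EuclideanSpace ℝ (Fin 4))) :
    EuclideanSpace ℝ (Fin 4) → Matrix (Fin 4) (Fin 4) ℝ :=
  fun x => Matrix.of (chartComponent g.val φ x)

/-! ### Double null coordinates

A coordinate vector is `x = (s, s̲, θ¹, θ²)`, i.e. `x 0 = s`, `x 1 = s̲`, `x 2 = θ¹`, `x 3 = θ²`.
In this part `G` is the matrix of metric components in such coordinates, and a vector (field) is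
given by its components in the coordinate frame `∂_s, ∂_s̲, ∂_1, ∂_2`. -/

/-- The position of the `i`-th angular coordinate. -/
def ang (i : Fin 2) : Fin 4 := ![2, 3] i

/-- The coordinate vector `(s, s̲, θ¹, θ²)`. -/
def pt (s us : ℝ) (θ : EuclideanSpace ℝ (Fin 2)) : EuclideanSpace ℝ (Fin 4) :=
  !₂[s, us, θ 0, θ 1]

section Background

variable (G : EuclideanSpace ℝ (Fin 4) → Matrix (Fin 4) (Fin 4) ℝ)

/-- The gradient vector field `∇u` of a function `u`. -/
def grad (u : EuclideanSpace ℝ (Fin 4) → ℝ) (x : EuclideanSpace ℝ (Fin 4)) : Fin 4 → ℝ :=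
  fun μ => ∑ ν, (G x)⁻¹ μ ν * pd u ν x

/-- The covariant derivative `∇_X V` at `x` of the vector field `V` in the direction `X`. -/
def cov (X : Fin 4 → ℝ) (V : EuclideanSpace ℝ (Fin 4) → Fin 4 → ℝ)
    (x : EuclideanSpace ℝ (Fin 4)) : Fin 4 → ℝ :=
  fun μ => ∑ ν, X ν * pd (fun y => V y μ) ν x +
    ∑ ν, ∑ ρ, christoffel G μ ν ρ x * X ν * V x ρ

/-- `L' = 2∇s`. -/
def L' (x : EuclideanSpace ℝ (Fin 4)) : Fin 4 → ℝ := (2 : ℝ) • grad G (fun y => y 0) x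

/-- `L̲' = 2∇s̲`. -/
def uL' (x : EuclideanSpace ℝ (Fin 4)) : Fin 4 → ℝ := (2 : ℝ) • grad G (fun y => y 1) x

/-- The positive function `Ω` with `2Ω⁻² = g(L', L̲')`. -/
def Om (x : EuclideanSpace ℝ (Fin 4)) : ℝ := Real.sqrt (2 / sprod (G x) (L' G x) (uL' G x))

/-- `L = Ω² L'`. -/
def L (x : EuclideanSpace ℝ (Fin 4)) : Fin 4 → ℝ := Om G x ^ 2 • L' G x

/-- `L̲ = Ω² L̲'`. -/
def uL (x : EuclideanSpace ℝ (Fin 4)) : Fin 4 → ℝ := Om G x ^ 2 • uL' G x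

/-- The vector field `b = L̲ - ∂_s`. -/
def bvec (x : EuclideanSpace ℝ (Fin 4)) : Fin 4 → ℝ := uL G x - Pi.single 0 1

/-- The angular coordinate vector field `∂_i`. -/
def dAng (i : Fin 2) : Fin 4 → ℝ := Pi.single (ang i) 1

/-- The induced metric `g̸_{ij} = g(∂_i, ∂_j)` on the surfaces `Σ_{s,s̲}`. -/
def slashG (x : EuclideanSpace ℝ (Fin 4)) : Matrix (Fin 2) (Fin 2) ℝ :=
  Matrix.of fun i j => sprod (G x) (dAng i) (dAng j)

/-- The Christoffel symbols `Γ̸^k_{ij}` of the surface `(Σ_{s,s̲}, g̸)` at `(s, s̲, θ)`. -/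
def slashChristoffel (k i j : Fin 2) (s us : ℝ) (θ : EuclideanSpace ℝ (Fin 2)) : ℝ :=
  christoffel (fun y => slashG G (pt s us y)) k i j θ

/-- `χ_{ij} = g(∇_{∂_i} L, ∂_j)`. -/
def chi (x : EuclideanSpace ℝ (Fin 4)) (i j : Fin 2) : ℝ :=
  sprod (G x) (cov G (dAng i) (L G) x) (dAng j)

/-- `χ̲_{ij} = g(∇_{∂_i} L̲, ∂_j)`. -/
def uchi (x : EuclideanSpace ℝ (Fin 4)) (i j : Fin 2) : ℝ :=
  sprod (G x) (cov G (dAng i) (uL G) x) (dAng j)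

/-- `η_i = ½ g(∇_{∂_i} L̲, L')`. -/
def eta (x : EuclideanSpace ℝ (Fin 4)) (i : Fin 2) : ℝ :=
  (1 / 2) * sprod (G x) (cov G (dAng i) (uL G) x) (L' G x)

/-- `η̲_i = ½ g(∇_{∂_i} L, L̲')`. -/
def ueta (x : EuclideanSpace ℝ (Fin 4)) (i : Fin 2) : ℝ :=
  (1 / 2) * sprod (G x) (cov G (dAng i) (L G) x) (uL' G x)

/-- `ω = L (log Ω)`. -/
def omega (x : EuclideanSpace ℝ (Fin 4)) : ℝ :=
  ∑ μ, L G x μ * pd (fun y => Real.log (Om G y)) μ x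

end Background

/-- The chart `φ = (s, s̲, θ¹, θ²)` is a double null coordinate system of `(M, g)`. -/
structure IsDoubleNullCoordinates {M : Type*} [TopologicalSpace M]
    [ChartedSpace (EuclideanSpace ℝ (Fin 4)) M] (g : LorentzMetric M)
    (φ : OpenPartialHomeomorph M (EuclideanSpace ℝ (Fin 4))) : Prop where
  smooth_chart : φ ∈ IsManifold.maximalAtlas (𝓡 4) ∞ M
  /-- Eikonal equation `g(∇s, ∇s) = 0`. -/
  eikonal_s : ∀ x ∈ φ.target, sprod (g.inChart φ x)
    (grad (g.inChart φ) (fun y => y 0) x) (grad (g.inChart φ) (fun y => y 0) x) = 0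
  /-- Eikonal equation `g(∇s̲, ∇s̲) = 0`. -/
  eikonal_us : ∀ x ∈ φ.target, sprod (g.inChart φ x)
    (grad (g.inChart φ) (fun y => y 1) x) (grad (g.inChart φ) (fun y => y 1) x) = 0
  /-- `g(L', L̲') > 0`, so that `2Ω⁻² = g(L', L̲')` defines a function `Ω > 0`. This is the
  case when `s̲` increases and `s` decreases in the future direction. -/
  pos : ∀ x ∈ φ.target, 0 < sprod (g.inChart φ x) (L' (g.inChart φ) x) (uL' (g.inChart φ) x)
  /-- `θ¹, θ²` are constant along the integral curves of `L`. -/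
  L_theta : ∀ x ∈ φ.target, ∀ a : Fin 2, L (g.inChart φ) x (ang a) = 0
  /-- On the hypersurface `s̲ = 0`, `θ¹, θ²` are constant along the integral curves of `L̲`. -/
  uL_theta : ∀ x ∈ φ.target, x 1 = 0 → ∀ a : Fin 2, uL (g.inChart φ) x (ang a) = 0

/-! ### Surfaces parametrised by two functions `(f, f̲)`

The surface is the image of `θ ↦ (s, s̲, θ) = (f(θ), f̲(θ), θ)`. -/

section Surface

variable (G : EuclideanSpace ℝ (Fin 4) → Matrix (Fin 4) (Fin 4) ℝ)
  (f uf : EuclideanSpace ℝ (Fin 2) → ℝ)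

/-- The parametrisation `θ ↦ (f(θ), f̲(θ), θ)`. -/
def emb (θ : EuclideanSpace ℝ (Fin 2)) : EuclideanSpace ℝ (Fin 4) := pt (f θ) (uf θ) θ

/-- The tangential coordinate frame `∂̇_i = ∂_i + f_i ∂_s + f̲_i ∂_s̲` of the surface. -/
def dDot (i : Fin 2) (θ : EuclideanSpace ℝ (Fin 2)) : Fin 4 → ℝ :=
  dAng i + pd f i θ • (Pi.single 0 1 : Fin 4 → ℝ) + pd uf i θ • (Pi.single 1 1 : Fin 4 → ℝ)

/-- The intrinsic metric `g(∂̇_i, ∂̇_j)` of the surface. -/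
def dotSlashG (θ : EuclideanSpace ℝ (Fin 2)) : Matrix (Fin 2) (Fin 2) ℝ :=
  Matrix.of fun i j => sprod (G (emb f uf θ)) (dDot f uf i θ) (dDot f uf j θ)

/-- The covariant derivative `∇_{∂̇_i} V` of a vector field `V` along the surface (a vector field of
the ambient manifold, given at the points of the surface only). -/
def covAlong (i : Fin 2) (V : EuclideanSpace ℝ (Fin 2) → Fin 4 → ℝ)
    (θ : EuclideanSpace ℝ (Fin 2)) : Fin 4 → ℝ :=
  fun μ => pd (fun y => V y μ) i θ +
    ∑ ν, ∑ ρ, christoffel G μ ν ρ (emb f uf θ) * dDot f uf i θ ν * V θ ρ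

/-- The matrix `B_i^j = δ_i^j - f_i b^j` (row `i`, column `j`). -/
def Bmat (θ : EuclideanSpace ℝ (Fin 2)) : Matrix (Fin 2) (Fin 2) ℝ :=
  Matrix.of fun i j => (if i = j then 1 else 0) - pd f i θ * bvec G (emb f uf θ) (ang j)

/-- `e^k = -2Ω² f_i (B⁻¹)_j^i (g̸⁻¹)^{jk}`. -/
def e (θ : EuclideanSpace ℝ (Fin 2)) : Fin 2 → ℝ := fun k =>
  -2 * Om G (emb f uf θ) ^ 2 *
    ∑ i, ∑ j, pd f i θ * (Bmat G f uf θ)⁻¹ j i * (slashG G (emb f uf θ))⁻¹ j k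

/-- `e̲^k = -2Ω² f̲_i (B⁻¹)_j^i (g̸⁻¹)^{jk}`. -/
def ue (θ : EuclideanSpace ℝ (Fin 2)) : Fin 2 → ℝ := fun k =>
  -2 * Om G (emb f uf θ) ^ 2 *
    ∑ i, ∑ j, pd uf i θ * (Bmat G f uf θ)⁻¹ j i * (slashG G (emb f uf θ))⁻¹ j k

/-- `(2Ω² + e·e̲) + √((2Ω² + e·e̲)² - |e|²|e̲|²)`. -/
def epsDen (θ : EuclideanSpace ℝ (Fin 2)) : ℝ :=
  (2 * Om G (emb f uf θ) ^ 2 + sprod (slashG G (emb f uf θ)) (e G f uf θ) (ue G f uf θ)) +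
    Real.sqrt
      ((2 * Om G (emb f uf θ) ^ 2
          + sprod (slashG G (emb f uf θ)) (e G f uf θ) (ue G f uf θ)) ^ 2
        - sprod (slashG G (emb f uf θ)) (e G f uf θ) (e G f uf θ)
          * sprod (slashG G (emb f uf θ)) (ue G f uf θ) (ue G f uf θ))

/-- `ε`. -/
def eps (θ : EuclideanSpace ℝ (Fin 2)) : ℝ :=
  -sprod (slashG G (emb f uf θ)) (e G f uf θ) (e G f uf θ) / epsDen G f uf θ

/-- `ε̲`. -/
def ueps (θ : EuclideanSpace ℝ (Fin 2)) : ℝ :=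
  -sprod (slashG G (emb f uf θ)) (ue G f uf θ) (ue G f uf θ) / epsDen G f uf θ

/-- The null normal field `L̇ = L + ε L̲ + ε^k ∂_k`, with `ε^k = e^k + ε e̲^k`. -/
def dotL (θ : EuclideanSpace ℝ (Fin 2)) : Fin 4 → ℝ :=
  L G (emb f uf θ) + eps G f uf θ • uL G (emb f uf θ) +
    ∑ k, (e G f uf θ k + eps G f uf θ * ue G f uf θ k) • dAng k

/-- The null normal field `L̲̇ = L̲ + ε̲ L + ε̲^k ∂_k`, with `ε̲^k = e̲^k + ε̲ e^k`. -/
def dotuL (θ : EuclideanSpace ℝ (Fin 2)) : Fin 4 → ℝ :=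
  uL G (emb f uf θ) + ueps G f uf θ • L G (emb f uf θ) +
    ∑ k, (ue G f uf θ k + ueps G f uf θ * e G f uf θ k) • dAng k

/-- The function `Ω̇` with `2Ω̇² = g(L̲̇, L̇)`. -/
def dotOm (θ : EuclideanSpace ℝ (Fin 2)) : ℝ :=
  Real.sqrt (sprod (G (emb f uf θ)) (dotuL G f uf θ) (dotL G f uf θ) / 2)

/-- `L̇' = Ω̇⁻² L̇`. -/
def dotL' (θ : EuclideanSpace ℝ (Fin 2)) : Fin 4 → ℝ :=
  (dotOm G f uf θ ^ 2)⁻¹ • dotL G f uf θ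

/-- `χ̇_{ij} = g(∇_{∂̇_i} L̇, ∂̇_j)`. -/
def dotChi (θ : EuclideanSpace ℝ (Fin 2)) (i j : Fin 2) : ℝ :=
  sprod (G (emb f uf θ)) (covAlong G f uf i (dotL G f uf) θ) (dDot f uf j θ)

/-- `χ̲̇_{ij} = g(∇_{∂̇_i} L̲̇, ∂̇_j)`. -/
def dotuChi (θ : EuclideanSpace ℝ (Fin 2)) (i j : Fin 2) : ℝ :=
  sprod (G (emb f uf θ)) (covAlong G f uf i (dotuL G f uf) θ) (dDot f uf j θ)

/-- `η̇_i = ½ g(∇_{∂̇_i} L̲̇, L̇')`. -/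
def dotEta (θ : EuclideanSpace ℝ (Fin 2)) (i : Fin 2) : ℝ :=
  (1 / 2) * sprod (G (emb f uf θ)) (covAlong G f uf i (dotuL G f uf) θ) (dotL' G f uf θ)

/-- The Hessian `∇̸²_{ij} u = ∂̇_i ∂̇_j u - Γ̸^k_{ij} ∂̇_k u` of a function `u` on the surface, for the
pulled back connection `∇̸`. -/
def slashHess (u : EuclideanSpace ℝ (Fin 2) → ℝ) (θ : EuclideanSpace ℝ (Fin 2)) (i j : Fin 2) : ℝ :=
  pd (pd u j) i θ - ∑ k, slashChristoffel G k i j (f θ) (uf θ) θ * pd u k θ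

/-- `∇̸^k u = (g̸⁻¹)^{kj} u_j`, for a function `u` on the surface. -/
def slashGrad (u : EuclideanSpace ℝ (Fin 2) → ℝ) (θ : EuclideanSpace ℝ (Fin 2)) : Fin 2 → ℝ :=
  fun k => ∑ j, (slashG G (emb f uf θ))⁻¹ k j * pd u j θ

end Surface

/-! ### Algebra of tensors on a 2-dimensional space -/

/-- The trace `(h⁻¹)^{ij} T_{ij}` of `T` with respect to the metric `h`. -/
def tr (h : Matrix (Fin 2) (Fin 2) ℝ) (T : Fin 2 → Fin 2 → ℝ) : ℝ := ∑ i, ∑ j, h⁻¹ i j * T i j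

/-- The inner product `(h⁻¹)^{ij} P_i Q_j` of covectors with respect to the metric `h`. -/
def codot (h : Matrix (Fin 2) (Fin 2) ℝ) (P Q : Fin 2 → ℝ) : ℝ := ∑ i, ∑ j, h⁻¹ i j * P i * Q j

/-- The symmetrised product `sym(P ⊗ Q)_{ij} = ½ (P_i Q_j + P_j Q_i)`. -/
def symm2 (P Q : Fin 2 → ℝ) (i j : Fin 2) : ℝ := (1 / 2) * (P i * Q j + P j * Q i)

/-- The covector `T(V)_i = T_{ij} V^j`. -/
def contr (T : Fin 2 → Fin 2 → ℝ) (V : Fin 2 → ℝ) : Fin 2 → ℝ := fun i => ∑ j, T i j * V j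

/-- The surface `S ⊆ M` is spacelike, of class `C²`, and it is parametrised by `(f, f̲)`, over the
open set `U` of angular coordinates, in the coordinate system `φ = (s, s̲, θ¹, θ²)`. -/
structure IsParametrisedBy {M : Type*} [TopologicalSpace M]
    [ChartedSpace (EuclideanSpace ℝ (Fin 4)) M] (g : LorentzMetric M)
    (φ : OpenPartialHomeomorph M (EuclideanSpace ℝ (Fin 4))) (S : Set M)
    (U : Set (EuclideanSpace ℝ (Fin 2))) (f uf : EuclideanSpace ℝ (Fin 2) → ℝ) : Prop where
  isOpen : IsOpen U
  contDiff_f : ContDiffOn ℝ 2 f U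
  contDiff_uf : ContDiffOn ℝ 2 uf U
  mem_target : ∀ θ ∈ U, emb f uf θ ∈ φ.target
  eq_image : S = (fun θ => φ.symm (emb f uf θ)) '' U
  spacelike : ∀ θ ∈ U, (dotSlashG (g.inChart φ) f uf θ).PosDef

end

end DoubleNull

namespace DoubleNull

open Filter Topology

noncomputable section

/-! ### Calculus of partial derivatives -/

section Calculus

variable {n : ℕ} {u v : EuclideanSpace ℝ (Fin n) → ℝ} {x : EuclideanSpace ℝ (Fin n)}

/-! The proof is a comparison of first derivatives of metric components. The gradients of `s` and
`s̲` are columns of `G⁻¹`, so the eikonal equations, the normalisation of `Ω` and the transport of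
the angular coordinates along `L` together say that `L = ∂_s̲` and `g(L, ·) = 2Ω² ds` (`L_eq`,
`apply_one`). Hence the `s̲`-row of `G` has the single nonzero entry `2Ω²`, and most first
derivatives that could occur vanish.

Every structure coefficient has the form `g(∇_X Z, Y)`. Lowering the index cancels the inverse
metric in the Christoffel symbols (`sprod_add_christoffel`), so each coefficient becomes a
combination of first derivatives of `G` and of the components of `Z`. This yields `chi_eq`,
`uchi_eq`, `eta_eq`, `ueta_eq` and `omega_eq`.

On a section with `f` constant, `e` and `ε` vanish, so `L̇ = L`, whereas `L̲̇ = L̲ - Ω²|df̲|² L -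
2Ω² ∇̸f̲`. The angular components of `L̲̇` involve the inverse of `g̸`; instead of differentiating
them explicitly, one differentiates the normality relation `g(L̲̇, ∂̇_j) = 0` along the surface
(`sum_mul_dotuL`, `sum_mul_pd_dotuL`). The product rule then gives exactly the contraction needed,
together with the second derivatives of `f̲`. What remains is a linear identity among derivatives of
the metric, and the traces follow because `∂̇_i` and `∂_i` have the same scalar products. -/

theorem pd_congr (h : u =ᶠ[𝓝 x] v) (μ : Fin n) : pd u μ x = pd v μ x := by
  simp only [pd, h.fderiv_eq]

theorem pd_of_eventuallyEq_const {c : ℝ} (h : u =ᶠ[𝓝 x] fun _ => c) (μ : Fin n) :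
    pd u μ x = 0 := by
  rw [pd_congr h]; simp [pd]

theorem pd_add (hu : DifferentiableAt ℝ u x) (hv : DifferentiableAt ℝ v x) (μ : Fin n) :
    pd (fun y => u y + v y) μ x = pd u μ x + pd v μ x := by
  simp [pd, fderiv_fun_add hu hv]

theorem pd_neg (μ : Fin n) : pd (fun y => -u y) μ x = -pd u μ x := by
  simp [pd]

theorem pd_mul (hu : DifferentiableAt ℝ u x) (hv : DifferentiableAt ℝ v x) (μ : Fin n) :
    pd (fun y => u y * v y) μ x = pd u μ x * v x + u x * pd v μ x := by
  simp [pd, fderiv_fun_mul hu hv]; ring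

theorem pd_const_mul (hu : DifferentiableAt ℝ u x) (c : ℝ) (μ : Fin n) :
    pd (fun y => c * u y) μ x = c * pd u μ x := by
  simp [pd, fderiv_const_mul hu c]

theorem pd_coord (c μ : Fin n) : pd (fun y => y c) μ x = if μ = c then 1 else 0 := by
  have h : HasFDerivAt (fun y : EuclideanSpace ℝ (Fin n) => y c)
      (EuclideanSpace.proj c : EuclideanSpace ℝ (Fin n) →L[ℝ] ℝ) x :=
    (EuclideanSpace.proj c : EuclideanSpace ℝ (Fin n) →L[ℝ] ℝ).hasFDerivAt
  simp [pd, h.fderiv, eq_comm]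

/-- The determinant of a matrix of differentiable functions is differentiable. -/
theorem differentiableAt_det {m : ℕ} {A : EuclideanSpace ℝ (Fin n) → Matrix (Fin m) (Fin m) ℝ}
    (hA : ∀ i j, DifferentiableAt ℝ (fun y => A y i j) x) :
    DifferentiableAt ℝ (fun y => (A y).det) x := by
  simp only [Matrix.det_apply']
  exact DifferentiableAt.fun_sum fun σ _ =>
    (HasFDerivAt.finsetProd fun i _ => (hA (σ i) i).hasFDerivAt).differentiableAt.const_mul _

/-- The inverse of a matrix of differentiable functions is differentiable where the determinant
does not vanish. -/
theorem differentiableAt_inv {m : ℕ} {A : EuclideanSpace ℝ (Fin n) → Matrix (Fin m) (Fin m) ℝ}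
    (hA : ∀ i j, DifferentiableAt ℝ (fun y => A y i j) x) (hd : (A x).det ≠ 0) (i j : Fin m) :
    DifferentiableAt ℝ (fun y => (A y)⁻¹ i j) x := by
  -- Cramer's rule: an entry of the adjugate is the determinant of the matrix with row `j` replaced
  -- by a constant basis vector, so its entries are either constant or entries of `A`.
  simp only [Matrix.inv_def, Matrix.smul_apply, Matrix.adjugate_apply, smul_eq_mul,
    Ring.inverse_eq_inv']
  refine ((differentiableAt_det hA).inv hd).mul (differentiableAt_det fun k l => ?_)
  by_cases hk : k = j
  · subst hk; simp
  · simpa [Matrix.updateRow_apply, hk] using hA k l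

end Calculus

/-! ### The covariant derivative with lowered index -/

/-- Christoffel symbols of the first kind `Γ_{σνρ} = g_{σμ} Γ^μ_{νρ}`. -/
def christoffelFst {n : ℕ} (G : EuclideanSpace ℝ (Fin n) → Matrix (Fin n) (Fin n) ℝ)
    (σ ν ρ : Fin n) (x : EuclideanSpace ℝ (Fin n)) : ℝ :=
  (1 / 2) * (pd (fun y => G y σ ρ) ν x + pd (fun y => G y σ ν) ρ x - pd (fun y => G y ν ρ) σ x)

theorem christoffel_eq {n : ℕ} (G : EuclideanSpace ℝ (Fin n) → Matrix (Fin n) (Fin n) ℝ)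
    (μ ν ρ : Fin n) (x : EuclideanSpace ℝ (Fin n)) :
    christoffel G μ ν ρ x = ∑ σ, (G x)⁻¹ μ σ * christoffelFst G σ ν ρ x := by
  simp only [christoffel, christoffelFst, Finset.mul_sum]
  exact Finset.sum_congr rfl fun σ _ => by ring

theorem sum_mul_christoffel {n : ℕ} {G : EuclideanSpace ℝ (Fin n) → Matrix (Fin n) (Fin n) ℝ}
    {x : EuclideanSpace ℝ (Fin n)} (hd : (G x).det ≠ 0) (σ ν ρ : Fin n) :
    ∑ μ, G x σ μ * christoffel G μ ν ρ x = christoffelFst G σ ν ρ x := by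
  have h1 : G x * (G x)⁻¹ = 1 := Matrix.mul_nonsing_inv _ (isUnit_iff_ne_zero.mpr hd)
  have h2 : (fun μ => christoffel G μ ν ρ x) =
      (G x)⁻¹.mulVec fun σ => christoffelFst G σ ν ρ x := by
    ext μ; rw [christoffel_eq]; rfl
  have h3 : (G x).mulVec (fun μ => christoffel G μ ν ρ x) =
      fun σ => christoffelFst G σ ν ρ x := by
    rw [h2, Matrix.mulVec_mulVec, h1, Matrix.one_mulVec]
  exact congrFun h3 σ

/-- Contraction of a vector of the form `A^μ + Γ^μ_{νρ} X^ν V^ρ` with a vector `Y`. -/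
theorem sprod_add_christoffel {n : ℕ}
    {G : EuclideanSpace ℝ (Fin n) → Matrix (Fin n) (Fin n) ℝ}
    {x : EuclideanSpace ℝ (Fin n)} (hd : (G x).det ≠ 0) (hs : (G x).IsSymm)
    (A X V Y : Fin n → ℝ) :
    sprod (G x) (fun μ => A μ + ∑ ν, ∑ ρ, christoffel G μ ν ρ x * X ν * V ρ) Y =
      sprod (G x) A Y + ∑ σ, Y σ * ∑ ν, X ν * ∑ ρ, V ρ * christoffelFst G σ ν ρ x := by
  have key : ∑ μ, ∑ σ, G x μ σ * (∑ ν, ∑ ρ, christoffel G μ ν ρ x * X ν * V ρ) * Y σ =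
      ∑ σ, Y σ * ∑ ν, X ν * ∑ ρ, V ρ * christoffelFst G σ ν ρ x := by
    rw [Finset.sum_comm]
    refine Finset.sum_congr rfl fun σ _ => ?_
    simp only [← sum_mul_christoffel hd, Finset.mul_sum, Finset.sum_mul]
    rw [Finset.sum_comm]
    refine Finset.sum_congr rfl fun ν _ => ?_
    rw [Finset.sum_comm]
    refine Finset.sum_congr rfl fun ρ _ => Finset.sum_congr rfl fun μ _ => ?_
    rw [hs.apply σ μ]; ring
  rw [← key]
  simp only [sprod, mul_add, add_mul, Finset.sum_add_distrib]

/-! ### The metric in double null coordinates -/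

/-- A smooth field `G` of symmetric matrices on an open set `V` which is the matrix of metric
components in coordinates `(s, s̲, θ¹, θ²)` for which `s` and `s̲` satisfy the eikonal equation and
`θ¹, θ²` are constant along the integral curves of `L`. -/
structure IsDoubleNullMetric (G : EuclideanSpace ℝ (Fin 4) → Matrix (Fin 4) (Fin 4) ℝ)
    (V : Set (EuclideanSpace ℝ (Fin 4))) : Prop where
  isOpen : IsOpen V
  isSymm : ∀ x ∈ V, (G x).IsSymm
  differentiableAt : ∀ x ∈ V, ∀ μ ν, DifferentiableAt ℝ (fun y => G y μ ν) x
  eikonal_s : ∀ x ∈ V, sprod (G x) (grad G (fun y => y 0) x) (grad G (fun y => y 0) x) = 0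
  eikonal_us : ∀ x ∈ V, sprod (G x) (grad G (fun y => y 1) x) (grad G (fun y => y 1) x) = 0
  pos : ∀ x ∈ V, 0 < sprod (G x) (L' G x) (uL' G x)
  L_theta : ∀ x ∈ V, ∀ a : Fin 2, L G x (ang a) = 0

theorem IsDoubleNullCoordinates.isDoubleNullMetric {M : Type*} [TopologicalSpace M]
    [ChartedSpace (EuclideanSpace ℝ (Fin 4)) M] {g : LorentzMetric M}
    {φ : OpenPartialHomeomorph M (EuclideanSpace ℝ (Fin 4))}
    (hφ : IsDoubleNullCoordinates g φ) : IsDoubleNullMetric (g.inChart φ) φ.target where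
  isOpen := φ.open_target
  isSymm x _ := by
    ext μ ν
    exact g.symm _ _ _
  differentiableAt x hx μ ν :=
    ((g.smooth φ hφ.smooth_chart μ ν).contDiffAt (φ.open_target.mem_nhds hx)).differentiableAt
      (by simp)
  eikonal_s := hφ.eikonal_s
  eikonal_us := hφ.eikonal_us
  pos := hφ.pos
  L_theta := hφ.L_theta

theorem grad_coord (G : EuclideanSpace ℝ (Fin 4) → Matrix (Fin 4) (Fin 4) ℝ)
    (x : EuclideanSpace ℝ (Fin 4)) (c μ : Fin 4) :
    grad G (fun y => y c) x μ = (G x)⁻¹ μ c := by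
  simp [grad, pd_coord]

namespace IsDoubleNullMetric

variable {G : EuclideanSpace ℝ (Fin 4) → Matrix (Fin 4) (Fin 4) ℝ}
  {V : Set (EuclideanSpace ℝ (Fin 4))} {x : EuclideanSpace ℝ (Fin 4)}

theorem det_ne_zero (hG : IsDoubleNullMetric G V) (hx : x ∈ V) : (G x).det ≠ 0 := by
  intro h
  -- A singular matrix has inverse `0` by convention, so all gradients would vanish, against `g(L',
  -- L̲') > 0`.
  have h0 : (G x)⁻¹ = 0 := Matrix.nonsing_inv_apply_not_isUnit _ (by simp [h])
  have := hG.pos x hx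
  simp [sprod, L', uL', grad_coord, h0] at this

theorem mul_inv (hG : IsDoubleNullMetric G V) (hx : x ∈ V) : G x * (G x)⁻¹ = 1 :=
  Matrix.mul_nonsing_inv _ (isUnit_iff_ne_zero.mpr (hG.det_ne_zero hx))

theorem inv_symm (hG : IsDoubleNullMetric G V) (hx : x ∈ V) (μ ν : Fin 4) :
    (G x)⁻¹ μ ν = (G x)⁻¹ ν μ := by
  have h : ((G x)⁻¹).IsSymm := by
    rw [Matrix.IsSymm, Matrix.transpose_nonsing_inv, (hG.isSymm x hx).eq]
  exact h.apply ν μ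

/-- Coordinate gradients are columns of `G⁻¹`; this turns the eikonal equations and the definition
of `Ω` into statements about single entries of the inverse metric. -/
theorem sprod_grad_coord (hG : IsDoubleNullMetric G V) (hx : x ∈ V) (c d : Fin 4) :
    sprod (G x) (grad G (fun y => y c) x) (grad G (fun y => y d) x) = (G x)⁻¹ c d := by
  have h : ∀ μ, ∑ ν, G x μ ν * (G x)⁻¹ ν d = if μ = d then 1 else 0 := fun μ => by
    rw [← Matrix.mul_apply, hG.mul_inv hx, Matrix.one_apply]
  calc sprod (G x) (grad G (fun y => y c) x) (grad G (fun y => y d) x)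
      = ∑ μ, (G x)⁻¹ μ c * ∑ ν, G x μ ν * (G x)⁻¹ ν d := by
        simp only [sprod, grad_coord, Finset.mul_sum]
        exact Finset.sum_congr rfl fun _ _ => Finset.sum_congr rfl fun _ _ => by ring
    _ = (G x)⁻¹ c d := by simp [h, hG.inv_symm hx d c]

theorem inv_zero_zero (hG : IsDoubleNullMetric G V) (hx : x ∈ V) : (G x)⁻¹ 0 0 = 0 := by
  rw [← hG.sprod_grad_coord hx]; exact hG.eikonal_s x hx

theorem inv_one_one (hG : IsDoubleNullMetric G V) (hx : x ∈ V) : (G x)⁻¹ 1 1 = 0 := by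
  rw [← hG.sprod_grad_coord hx]; exact hG.eikonal_us x hx

theorem sprod_L'_uL' (hG : IsDoubleNullMetric G V) (hx : x ∈ V) :
    sprod (G x) (L' G x) (uL' G x) = 4 * (G x)⁻¹ 0 1 := by
  rw [← hG.sprod_grad_coord hx]
  simp only [sprod, L', uL', Pi.smul_apply, smul_eq_mul, Finset.mul_sum]
  exact Finset.sum_congr rfl fun _ _ => Finset.sum_congr rfl fun _ _ => by ring

theorem inv_zero_one_pos (hG : IsDoubleNullMetric G V) (hx : x ∈ V) : 0 < (G x)⁻¹ 0 1 := by
  have := hG.pos x hx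
  rw [hG.sprod_L'_uL' hx] at this
  linarith

theorem Om_sq (hG : IsDoubleNullMetric G V) (hx : x ∈ V) :
    Om G x ^ 2 = (2 * (G x)⁻¹ 0 1)⁻¹ := by
  have := hG.inv_zero_one_pos hx
  rw [Om, hG.sprod_L'_uL' hx, Real.sq_sqrt (by positivity)]
  field_simp; norm_num

theorem Om_pos (hG : IsDoubleNullMetric G V) (hx : x ∈ V) : 0 < Om G x := by
  have := hG.pos x hx
  exact Real.sqrt_pos.mpr (by positivity)

theorem L_apply (x : EuclideanSpace ℝ (Fin 4)) (μ : Fin 4) :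
    L G x μ = 2 * Om G x ^ 2 * (G x)⁻¹ μ 0 := by
  simp [L, L', grad_coord]; ring

theorem uL_apply (x : EuclideanSpace ℝ (Fin 4)) (μ : Fin 4) :
    uL G x μ = 2 * Om G x ^ 2 * (G x)⁻¹ μ 1 := by
  simp [uL, uL', grad_coord]; ring

/-- The components are `2Ω² (G⁻¹)^{μ0}`: the eikonal equation kills the `s`-component, the
normalisation of `Ω` makes the `s̲`-component `1`, and the angular ones vanish by assumption. As `L`
has constant components, its covariant derivative is purely a Christoffel term. -/
theorem L_eq (hG : IsDoubleNullMetric G V) (hx : x ∈ V) : L G x = Pi.single 1 1 := by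
  have h0 := hG.inv_zero_one_pos hx
  have h2 := hG.L_theta x hx 0
  have h3 := hG.L_theta x hx 1
  ext μ
  fin_cases μ
  · simp [L_apply, hG.inv_zero_zero hx]
  · have : (2 * ((G x)⁻¹ 0 1))⁻¹ * (2 * (G x)⁻¹ 0 1) = 1 := inv_mul_cancel₀ (by positivity)
    simp only [L_apply, hG.Om_sq hx, hG.inv_symm hx 1 0, Fin.mk_one, Pi.single_eq_same]
    linarith
  · simpa [ang] using h2
  · simpa [ang] using h3

theorem uL_zero (hG : IsDoubleNullMetric G V) (hx : x ∈ V) : uL G x 0 = 1 := by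
  have h0 := hG.inv_zero_one_pos hx
  have : (2 * ((G x)⁻¹ 0 1))⁻¹ * (2 * (G x)⁻¹ 0 1) = 1 := inv_mul_cancel₀ (by positivity)
  rw [uL_apply, hG.Om_sq hx]; linarith

theorem uL_one (hG : IsDoubleNullMetric G V) (hx : x ∈ V) : uL G x 1 = 0 := by
  simp [uL_apply, hG.inv_one_one hx]

theorem sum_mul_L (hG : IsDoubleNullMetric G V) (hx : x ∈ V) (μ : Fin 4) :
    ∑ ν, G x μ ν * L G x ν = if μ = 0 then 2 * Om G x ^ 2 else 0 := by
  have h : ∑ ν, G x μ ν * (G x)⁻¹ ν 0 = if μ = 0 then 1 else 0 := by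
    rw [← Matrix.mul_apply, hG.mul_inv hx, Matrix.one_apply]
  calc ∑ ν, G x μ ν * L G x ν = 2 * Om G x ^ 2 * ∑ ν, G x μ ν * (G x)⁻¹ ν 0 := by
        simp only [L_apply, Finset.mul_sum]
        exact Finset.sum_congr rfl fun _ _ => by ring
    _ = _ := by rw [h]; split_ifs <;> ring

theorem sum_mul_uL (hG : IsDoubleNullMetric G V) (hx : x ∈ V) (μ : Fin 4) :
    ∑ ν, G x μ ν * uL G x ν = if μ = 1 then 2 * Om G x ^ 2 else 0 := by
  have h : ∑ ν, G x μ ν * (G x)⁻¹ ν 1 = if μ = 1 then 1 else 0 := by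
    rw [← Matrix.mul_apply, hG.mul_inv hx, Matrix.one_apply]
  calc ∑ ν, G x μ ν * uL G x ν = 2 * Om G x ^ 2 * ∑ ν, G x μ ν * (G x)⁻¹ ν 1 := by
        simp only [uL_apply, Finset.mul_sum]
        exact Finset.sum_congr rfl fun _ _ => by ring
    _ = _ := by rw [h]; split_ifs <;> ring

/-- The covector `g(L, ·) = 2 Ω² ds`. -/
theorem apply_one (hG : IsDoubleNullMetric G V) (hx : x ∈ V) (μ : Fin 4) :
    G x μ 1 = if μ = 0 then 2 * Om G x ^ 2 else 0 := by
  rw [← hG.sum_mul_L hx, hG.L_eq hx, Fin.sum_univ_four]; simp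

theorem one_apply (hG : IsDoubleNullMetric G V) (hx : x ∈ V) (μ : Fin 4) :
    G x 1 μ = if μ = 0 then 2 * Om G x ^ 2 else 0 := by
  rw [← hG.apply_one hx, (hG.isSymm x hx).apply]

/-- `g(L̲, ∂_i) = 0`, which expresses the shift covector by `b`. -/
theorem zero_ang (hG : IsDoubleNullMetric G V) (hx : x ∈ V) (i : Fin 2) :
    G x 0 (ang i) = -∑ a, G x (ang i) (ang a) * uL G x (ang a) := by
  have h := hG.sum_mul_uL hx (ang i)
  rw [if_neg (by fin_cases i <;> decide)] at h
  rw [Fin.sum_univ_four, hG.uL_zero hx, hG.uL_one hx, ← (hG.isSymm x hx).apply] at h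
  simp only [Fin.sum_univ_two, ang, Matrix.cons_val_zero, Matrix.cons_val_one,
    Matrix.cons_val_fin_one] at h ⊢
  linarith

theorem differentiableAt_Om_sq (hG : IsDoubleNullMetric G V) (hx : x ∈ V) :
    DifferentiableAt ℝ (fun y => Om G y ^ 2) x := by
  -- Reading `Ω²` off a metric component avoids differentiating the square root.
  have h : (fun y => Om G y ^ 2) =ᶠ[𝓝 x] fun y => (1 / 2) * G y 0 1 := by
    filter_upwards [hG.isOpen.mem_nhds hx] with y hy
    rw [hG.apply_one hy]; simp
  exact ((hG.differentiableAt x hx 0 1).const_mul _).congr_of_eventuallyEq h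

theorem differentiableAt_uL (hG : IsDoubleNullMetric G V) (hx : x ∈ V) (μ : Fin 4) :
    DifferentiableAt ℝ (fun y => uL G y μ) x := by
  simp only [uL_apply]
  exact ((hG.differentiableAt_Om_sq hx).const_mul 2).mul
    (differentiableAt_inv (hG.differentiableAt x hx) (hG.det_ne_zero hx) μ 1)

end IsDoubleNullMetric

/-! ### Structure coefficients of the coordinate surfaces in terms of derivatives of the metric -/

theorem sum_fin_four (F : Fin 4 → ℝ) : ∑ μ, F μ = F 0 + F 1 + ∑ a, F (ang a) := by
  simp [Fin.sum_univ_four, ang, Fin.sum_univ_two, add_assoc]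

theorem ang_ne_zero (a : Fin 2) : ang a ≠ 0 := by fin_cases a <;> decide

theorem ang_ne_one (a : Fin 2) : ang a ≠ 1 := by fin_cases a <;> decide

theorem ang_injective : Function.Injective ang := by decide

@[simp] theorem dAng_zero (i : Fin 2) : dAng i 0 = 0 := by
  simp [dAng, (ang_ne_zero i).symm]

@[simp] theorem dAng_one (i : Fin 2) : dAng i 1 = 0 := by
  simp [dAng, (ang_ne_one i).symm]

@[simp] theorem dAng_ang (i a : Fin 2) : dAng i (ang a) = if a = i then 1 else 0 := by
  simp [dAng, Pi.single_apply, ang_injective.eq_iff]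

theorem slashG_apply (G : EuclideanSpace ℝ (Fin 4) → Matrix (Fin 4) (Fin 4) ℝ)
    (x : EuclideanSpace ℝ (Fin 4)) (i j : Fin 2) : slashG G x i j = G x (ang i) (ang j) := by
  simp [slashG, sprod, sum_fin_four]

namespace IsDoubleNullMetric

variable {G : EuclideanSpace ℝ (Fin 4) → Matrix (Fin 4) (Fin 4) ℝ}
  {V : Set (EuclideanSpace ℝ (Fin 4))} {x : EuclideanSpace ℝ (Fin 4)}

theorem pd_comm (hG : IsDoubleNullMetric G V) (hx : x ∈ V) (μ ν ρ : Fin 4) :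
    pd (fun y => G y μ ν) ρ x = pd (fun y => G y ν μ) ρ x :=
  pd_congr (by
    filter_upwards [hG.isOpen.mem_nhds hx] with y hy
    exact (hG.isSymm y hy).apply ν μ) ρ

theorem pd_one_zero (hG : IsDoubleNullMetric G V) (hx : x ∈ V) (ρ : Fin 4) :
    pd (fun y => G y 1 0) ρ x = 2 * pd (fun y => Om G y ^ 2) ρ x := by
  rw [← pd_const_mul (hG.differentiableAt_Om_sq hx)]
  refine pd_congr ?_ ρ
  filter_upwards [hG.isOpen.mem_nhds hx] with y hy
  simp [hG.one_apply hy]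

theorem pd_zero_one (hG : IsDoubleNullMetric G V) (hx : x ∈ V) (ρ : Fin 4) :
    pd (fun y => G y 0 1) ρ x = 2 * pd (fun y => Om G y ^ 2) ρ x := by
  rw [hG.pd_comm hx, hG.pd_one_zero hx]

theorem pd_one_one (hG : IsDoubleNullMetric G V) (hx : x ∈ V) (ρ : Fin 4) :
    pd (fun y => G y 1 1) ρ x = 0 := by
  refine pd_of_eventuallyEq_const (c := 0) ?_ ρ
  filter_upwards [hG.isOpen.mem_nhds hx] with y hy
  simp [hG.one_apply hy]

theorem pd_one_ang (hG : IsDoubleNullMetric G V) (hx : x ∈ V) (a : Fin 2) (ρ : Fin 4) :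
    pd (fun y => G y 1 (ang a)) ρ x = 0 := by
  refine pd_of_eventuallyEq_const (c := 0) ?_ ρ
  filter_upwards [hG.isOpen.mem_nhds hx] with y hy
  simp [hG.one_apply hy, ang_ne_zero]

theorem pd_ang_one (hG : IsDoubleNullMetric G V) (hx : x ∈ V) (a : Fin 2) (ρ : Fin 4) :
    pd (fun y => G y (ang a) 1) ρ x = 0 := by
  rw [hG.pd_comm hx, hG.pd_one_ang hx]

theorem pd_ang_zero (hG : IsDoubleNullMetric G V) (hx : x ∈ V) (a : Fin 2) (ρ : Fin 4) :
    pd (fun y => G y (ang a) 0) ρ x = pd (fun y => G y 0 (ang a)) ρ x :=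
  hG.pd_comm hx _ _ _

theorem sprod_cov (hG : IsDoubleNullMetric G V) (hx : x ∈ V) (X Y : Fin 4 → ℝ)
    (Z : EuclideanSpace ℝ (Fin 4) → Fin 4 → ℝ) :
    sprod (G x) (cov G X Z x) Y =
      sprod (G x) (fun μ => ∑ ν, X ν * pd (fun y => Z y μ) ν x) Y +
        ∑ σ, Y σ * ∑ ν, X ν * ∑ ρ, Z x ρ * christoffelFst G σ ν ρ x :=
  sprod_add_christoffel (hG.det_ne_zero hx) (hG.isSymm x hx) _ X (Z x) Y

theorem pd_L (hG : IsDoubleNullMetric G V) (hx : x ∈ V) (μ ν : Fin 4) :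
    pd (fun y => L G y μ) ν x = 0 := by
  refine pd_of_eventuallyEq_const (c := (Pi.single 1 1 : Fin 4 → ℝ) μ) ?_ ν
  filter_upwards [hG.isOpen.mem_nhds hx] with y hy
  rw [hG.L_eq hy]

theorem pd_uL_zero (hG : IsDoubleNullMetric G V) (hx : x ∈ V) (ν : Fin 4) :
    pd (fun y => uL G y 0) ν x = 0 := by
  refine pd_of_eventuallyEq_const (c := 1) ?_ ν
  filter_upwards [hG.isOpen.mem_nhds hx] with y hy
  rw [hG.uL_zero hy]

/-- `χ_{ij} = ½ L(g̸_{ij})`. -/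
theorem chi_eq (hG : IsDoubleNullMetric G V) (hx : x ∈ V) (i j : Fin 2) :
    chi G x i j = (1 / 2) * pd (fun y => G y (ang i) (ang j)) 1 x := by
  rw [chi, hG.sprod_cov hx]
  simp only [hG.pd_L hx, hG.L_eq hx]
  simp [sprod, sum_fin_four, christoffelFst, hG.pd_ang_one hx, hG.pd_one_ang hx,
    Pi.single_apply]
  rw [hG.pd_comm hx]

theorem Om_sq_smul_L' (x : EuclideanSpace ℝ (Fin 4)) : Om G x ^ 2 • L' G x = L G x := rfl

theorem Om_sq_smul_uL' (x : EuclideanSpace ℝ (Fin 4)) : Om G x ^ 2 • uL' G x = uL G x := rfl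

theorem sprod_smul_right {n : ℕ} (A : Matrix (Fin n) (Fin n) ℝ) (c : ℝ) (X Y : Fin n → ℝ) :
    sprod A X (c • Y) = c * sprod A X Y := by
  simp only [sprod, Finset.mul_sum, Pi.smul_apply, smul_eq_mul]
  exact Finset.sum_congr rfl fun _ _ => Finset.sum_congr rfl fun _ _ => by ring

/-- The factor `4Ω²` turns `L̲'` into `L̲` and clears the denominators; `eta_eq` uses the same
normalisation. -/
theorem ueta_eq (hG : IsDoubleNullMetric G V) (hx : x ∈ V) (i : Fin 2) :
    4 * Om G x ^ 2 * ueta G x i =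
      2 * pd (fun y => Om G y ^ 2) (ang i) x + pd (fun y => G y 0 (ang i)) 1 x +
        ∑ a, uL G x (ang a) * pd (fun y => G y (ang a) (ang i)) 1 x := by
  have h : 4 * Om G x ^ 2 * ueta G x i = 2 * sprod (G x) (cov G (dAng i) (L G) x) (uL G x) := by
    rw [← Om_sq_smul_uL', sprod_smul_right, ueta]; ring
  rw [h, hG.sprod_cov hx]
  simp only [hG.pd_L hx, hG.L_eq hx]
  simp [sprod, sum_fin_four, christoffelFst, hG.pd_ang_one hx, hG.pd_one_ang hx,
    Pi.single_apply, hG.uL_zero hx, hG.uL_one hx, hG.pd_zero_one hx]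
  ring

theorem eta_eq (hG : IsDoubleNullMetric G V) (hx : x ∈ V) (i : Fin 2) :
    4 * Om G x ^ 2 * eta G x i =
      2 * pd (fun y => Om G y ^ 2) (ang i) x - pd (fun y => G y 0 (ang i)) 1 x -
        ∑ a, uL G x (ang a) * pd (fun y => G y (ang i) (ang a)) 1 x := by
  have h : 4 * Om G x ^ 2 * eta G x i = 2 * sprod (G x) (cov G (dAng i) (uL G) x) (L G x) := by
    rw [← Om_sq_smul_L', sprod_smul_right, eta]; ring
  rw [h, hG.sprod_cov hx]
  simp only [hG.L_eq hx]
  simp [sprod, sum_fin_four, christoffelFst, hG.pd_one_ang hx, hG.apply_one hx,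
    Pi.single_apply, hG.uL_zero hx, hG.uL_one hx, hG.pd_one_zero hx,
    hG.pd_uL_zero hx, hG.pd_ang_zero hx]
  ring

/-- Product rule applied to `g(L̲, ∂_j) = 0`. It supplies the derivatives of the shift `b` already
contracted with `g̸`, the only form in which `χ̲` needs them. -/
theorem pd_zero_ang (hG : IsDoubleNullMetric G V) (hx : x ∈ V) (j : Fin 2) (ν : Fin 4) :
    ∑ a, G x (ang j) (ang a) * pd (fun y => uL G y (ang a)) ν x =
      -pd (fun y => G y 0 (ang j)) ν x -
        ∑ a, pd (fun y => G y (ang j) (ang a)) ν x * uL G x (ang a) := by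
  have hd := hG.differentiableAt x hx
  have hu := hG.differentiableAt_uL hx
  have h : pd (fun y => G y 0 (ang j)) ν x =
      pd (fun y => -(G y (ang j) (ang 0) * uL G y (ang 0) +
        G y (ang j) (ang 1) * uL G y (ang 1))) ν x := by
    refine pd_congr ?_ ν
    filter_upwards [hG.isOpen.mem_nhds hx] with y hy
    rw [hG.zero_ang hy, Fin.sum_univ_two]
  rw [h, pd_neg, pd_add ((hd _ _).fun_mul (hu _)) ((hd _ _).fun_mul (hu _)), pd_mul (hd _ _) (hu _),
    pd_mul (hd _ _) (hu _)]
  simp only [Fin.sum_univ_two]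
  ring

theorem uchi_eq (hG : IsDoubleNullMetric G V) (hx : x ∈ V) (i j : Fin 2) :
    2 * uchi G x i j =
      pd (fun y => G y (ang i) (ang j)) 0 x - pd (fun y => G y 0 (ang j)) (ang i) x -
        pd (fun y => G y 0 (ang i)) (ang j) x +
        ∑ a, uL G x (ang a) * (pd (fun y => G y (ang i) (ang j)) (ang a) x -
          pd (fun y => G y (ang j) (ang a)) (ang i) x -
          pd (fun y => G y (ang i) (ang a)) (ang j) x) := by
  have h := hG.pd_zero_ang hx j (ang i)
  rw [uchi, hG.sprod_cov hx]
  simp [sprod, sum_fin_four, christoffelFst, hG.one_apply hx, ang_ne_zero,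
    hG.uL_zero hx, hG.uL_one hx, hG.pd_uL_zero hx, hG.pd_ang_zero hx]
  simp only [Fin.sum_univ_two] at h ⊢
  simp only [hG.pd_comm hx (ang j) (ang i)]
  rw [(hG.isSymm x hx).apply (ang j), (hG.isSymm x hx).apply (ang j)]
  linear_combination 2 * h

theorem omega_eq (hG : IsDoubleNullMetric G V) (hx : x ∈ V) :
    2 * Om G x ^ 2 * omega G x = pd (fun y => Om G y ^ 2) 1 x := by
  have hp : Om G x ^ 2 ≠ 0 := (pow_pos (hG.Om_pos hx) 2).ne'
  have h1 : omega G x = pd (fun y => Real.log (Om G y)) 1 x := by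
    simp [omega, hG.L_eq hx, Fin.sum_univ_four]
  -- Passing to `log Ω²` requires only the differentiability of `Ω²`.
  have h2 : (fun y => Real.log (Om G y)) = fun y => (1 / 2) * Real.log (Om G y ^ 2) := by
    ext y; rw [Real.log_pow]; push_cast; ring
  rw [h1, h2, pd_const_mul ((hG.differentiableAt_Om_sq hx).log hp)]
  simp only [pd]
  rw [fderiv.log (hG.differentiableAt_Om_sq hx) hp]
  generalize fderiv ℝ (fun y => Om G y ^ 2) x = D
  simp only [_root_.smul_apply, smul_eq_mul]
  generalize Om G x ^ 2 = W at hp ⊢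
  field_simp

end IsDoubleNullMetric

/-! ### Surfaces in a null hypersurface `C_{s₀}` -/

theorem pt_eq (s us : ℝ) (θ : EuclideanSpace ℝ (Fin 2)) :
    pt s us θ = s • EuclideanSpace.single 0 1 + us • EuclideanSpace.single 1 1 +
      ∑ a, θ a • EuclideanSpace.single (ang a) 1 := by
  ext μ
  fin_cases μ <;> simp [pt, ang, Fin.sum_univ_two]

/-- Chain rule along a surface parametrised by `(s₀, f̲)`. -/
theorem hasFDerivAt_emb {s₀ : ℝ} {uf : EuclideanSpace ℝ (Fin 2) → ℝ}
    {θ : EuclideanSpace ℝ (Fin 2)} (huf : DifferentiableAt ℝ uf θ) :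
    HasFDerivAt (emb (fun _ => s₀) uf)
      ((fderiv ℝ uf θ).smulRight (EuclideanSpace.single 1 1 : EuclideanSpace ℝ (Fin 4)) +
        ∑ a : Fin 2, (EuclideanSpace.proj a : EuclideanSpace ℝ (Fin 2) →L[ℝ] ℝ).smulRight
          (EuclideanSpace.single (ang a) 1 : EuclideanSpace ℝ (Fin 4))) θ := by
  have h : emb (fun _ => s₀) uf = fun y => s₀ • EuclideanSpace.single 0 1 +
      (uf y • EuclideanSpace.single 1 1 + ∑ a : Fin 2, y a • EuclideanSpace.single (ang a) 1) := by
    ext1 y; rw [emb, pt_eq, add_assoc]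
  rw [h]
  refine ((huf.hasFDerivAt.smul_const _).add (HasFDerivAt.fun_sum fun a _ => ?_)).const_add _
  exact (EuclideanSpace.proj a : EuclideanSpace ℝ (Fin 2) →L[ℝ] ℝ).hasFDerivAt.smul_const _

theorem pd_comp_emb {s₀ : ℝ} {uf : EuclideanSpace ℝ (Fin 2) → ℝ}
    {θ : EuclideanSpace ℝ (Fin 2)} (huf : DifferentiableAt ℝ uf θ)
    {F : EuclideanSpace ℝ (Fin 4) → ℝ} (hF : DifferentiableAt ℝ F (emb (fun _ => s₀) uf θ))
    (i : Fin 2) :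
    pd (fun y => F (emb (fun _ => s₀) uf y)) i θ =
      pd F (ang i) (emb (fun _ => s₀) uf θ) + pd uf i θ * pd F 1 (emb (fun _ => s₀) uf θ) := by
  have h := (hF.hasFDerivAt.comp θ (hasFDerivAt_emb (s₀ := s₀) huf)).fderiv
  simp only [Function.comp_def] at h
  simp only [pd, h]
  fin_cases i <;> simp [add_comm]

theorem pd_comp_pt {s us : ℝ} {θ : EuclideanSpace ℝ (Fin 2)}
    {F : EuclideanSpace ℝ (Fin 4) → ℝ} (hF : DifferentiableAt ℝ F (pt s us θ)) (i : Fin 2) :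
    pd (fun y => F (pt s us y)) i θ = pd F (ang i) (pt s us θ) := by
  have h := pd_comp_emb (s₀ := s) (uf := fun _ => us) (differentiableAt_const us) hF i
  simpa [emb, pd] using h

/-- The surface parametrised by `(s₀, f̲)` over the open set `U` lies in the domain `V` of double
null coordinates, is of class `C²`, and `g̸` is nondegenerate along it. -/
structure IsConeSection (G : EuclideanSpace ℝ (Fin 4) → Matrix (Fin 4) (Fin 4) ℝ)
    (V : Set (EuclideanSpace ℝ (Fin 4))) (U : Set (EuclideanSpace ℝ (Fin 2))) (s₀ : ℝ)
    (uf : EuclideanSpace ℝ (Fin 2) → ℝ) : Prop where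
  metric : IsDoubleNullMetric G V
  isOpen : IsOpen U
  contDiffOn : ContDiffOn ℝ 2 uf U
  mem : ∀ θ ∈ U, emb (fun _ => s₀) uf θ ∈ V
  det_slashG : ∀ θ ∈ U, (slashG G (emb (fun _ => s₀) uf θ)).det ≠ 0

/-! ### Frame quantities when `f` is constant -/

section Frame

variable (G : EuclideanSpace ℝ (Fin 4) → Matrix (Fin 4) (Fin 4) ℝ) (s₀ : ℝ)
  (uf : EuclideanSpace ℝ (Fin 2) → ℝ) (θ : EuclideanSpace ℝ (Fin 2))

theorem pd_const {n : ℕ} (c : ℝ) (i : Fin n) (x : EuclideanSpace ℝ (Fin n)) :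
    pd (fun _ => c) i x = 0 := by simp [pd]

@[simp] theorem dDot_zero (j : Fin 2) : dDot (fun _ => s₀) uf j θ 0 = 0 := by
  simp [dDot, pd_const]

@[simp] theorem dDot_one (j : Fin 2) : dDot (fun _ => s₀) uf j θ 1 = pd uf j θ := by
  simp [dDot, pd_const]

@[simp] theorem dDot_ang (j a : Fin 2) :
    dDot (fun _ => s₀) uf j θ (ang a) = if a = j then 1 else 0 := by
  simp [dDot, pd_const, ang_ne_one]

theorem e_eq_zero : e G (fun _ => s₀) uf θ = 0 := by
  ext k; simp [e, pd_const]

theorem eps_eq_zero : eps G (fun _ => s₀) uf θ = 0 := by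
  simp [eps, e_eq_zero, sprod]

theorem Bmat_eq_one : Bmat G (fun _ => s₀) uf θ = 1 := by
  ext i j; simp [Bmat, pd_const, Matrix.one_apply]

theorem dotL_eq : dotL G (fun _ => s₀) uf θ = L G (emb (fun _ => s₀) uf θ) := by
  simp [dotL, eps_eq_zero, e_eq_zero]

/-- Here `∂̇_i = ∂_i + f̲_i L`, and `L` is null and orthogonal to the angular fields. Besides
comparing traces, this transfers nondegeneracy from the spacelike surface to `g̸`. -/
theorem dotSlashG_eq {G : EuclideanSpace ℝ (Fin 4) → Matrix (Fin 4) (Fin 4) ℝ}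
    {V : Set (EuclideanSpace ℝ (Fin 4))} {s₀ : ℝ} {uf : EuclideanSpace ℝ (Fin 2) → ℝ}
    {θ : EuclideanSpace ℝ (Fin 2)} (hG : IsDoubleNullMetric G V)
    (hx : emb (fun _ => s₀) uf θ ∈ V) :
    dotSlashG G (fun _ => s₀) uf θ = slashG G (emb (fun _ => s₀) uf θ) := by
  ext i j
  rw [slashG_apply]
  simp [dotSlashG, sprod, sum_fin_four, hG.apply_one hx, hG.one_apply hx, ang_ne_zero]

end Frame

/-! ### The conjugate null normal of a section -/

namespace IsConeSection

variable {G : EuclideanSpace ℝ (Fin 4) → Matrix (Fin 4) (Fin 4) ℝ}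
  {V : Set (EuclideanSpace ℝ (Fin 4))} {U : Set (EuclideanSpace ℝ (Fin 2))} {s₀ : ℝ}
  {uf : EuclideanSpace ℝ (Fin 2) → ℝ} {θ : EuclideanSpace ℝ (Fin 2)}

theorem differentiableAt (hS : IsConeSection G V U s₀ uf) (hθ : θ ∈ U) :
    DifferentiableAt ℝ uf θ :=
  (hS.contDiffOn.contDiffAt (hS.isOpen.mem_nhds hθ)).differentiableAt (by simp)

theorem differentiableAt_pd (hS : IsConeSection G V U s₀ uf) (hθ : θ ∈ U) (i : Fin 2) :
    DifferentiableAt ℝ (fun y => pd uf i y) θ := by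
  have h : ContDiffAt ℝ 1 (fderiv ℝ uf) θ :=
    (hS.contDiffOn.contDiffAt (hS.isOpen.mem_nhds hθ)).fderiv_right (by norm_num)
  exact (h.differentiableAt (by simp)).clm_apply (differentiableAt_const _)

theorem differentiableAt_comp (hS : IsConeSection G V U s₀ uf) (hθ : θ ∈ U)
    {F : EuclideanSpace ℝ (Fin 4) → ℝ} (hF : DifferentiableAt ℝ F (emb (fun _ => s₀) uf θ)) :
    DifferentiableAt ℝ (fun y => F (emb (fun _ => s₀) uf y)) θ :=
  (hF.hasFDerivAt.comp θ (hasFDerivAt_emb (s₀ := s₀) (hS.differentiableAt hθ))).differentiableAt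

theorem slashG_isSymm (hS : IsConeSection G V U s₀ uf) (hθ : θ ∈ U) :
    (slashG G (emb (fun _ => s₀) uf θ)).IsSymm := by
  ext i j
  simp only [Matrix.transpose_apply, slashG_apply]
  exact (hS.metric.isSymm _ (hS.mem θ hθ)).apply _ _

theorem slashG_inv_symm (hS : IsConeSection G V U s₀ uf) (hθ : θ ∈ U) (i j : Fin 2) :
    (slashG G (emb (fun _ => s₀) uf θ))⁻¹ i j = (slashG G (emb (fun _ => s₀) uf θ))⁻¹ j i := by
  have h : ((slashG G (emb (fun _ => s₀) uf θ))⁻¹).IsSymm := by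
    rw [Matrix.IsSymm, Matrix.transpose_nonsing_inv, (hS.slashG_isSymm hθ).eq]
  exact h.apply j i

/-- `g̸_{jk} ∇̸^k f̲ = f̲_j`. -/
theorem sum_mul_slashGrad (hS : IsConeSection G V U s₀ uf) (hθ : θ ∈ U) (j : Fin 2) :
    ∑ k, G (emb (fun _ => s₀) uf θ) (ang j) (ang k) * slashGrad G (fun _ => s₀) uf uf θ k =
      pd uf j θ := by
  have h1 : slashGrad G (fun _ => s₀) uf uf θ =
    (slashG G (emb (fun _ => s₀) uf θ))⁻¹.mulVec fun j => pd uf j θ := rfl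
  have h2 : (slashG G (emb (fun _ => s₀) uf θ)).mulVec (slashGrad G (fun _ => s₀) uf uf θ) =
      fun j => pd uf j θ := by
    rw [h1, Matrix.mulVec_mulVec,
      Matrix.mul_nonsing_inv _ (isUnit_iff_ne_zero.mpr (hS.det_slashG θ hθ)), Matrix.one_mulVec]
  rw [← congrFun h2 j]
  simp [Matrix.mulVec, dotProduct, slashG_apply]

theorem ue_eq (hS : IsConeSection G V U s₀ uf) (hθ : θ ∈ U) (k : Fin 2) :
    ue G (fun _ => s₀) uf θ k =
      -2 * Om G (emb (fun _ => s₀) uf θ) ^ 2 * slashGrad G (fun _ => s₀) uf uf θ k := by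
  simp only [ue, Bmat_eq_one, inv_one, slashGrad, Fin.sum_univ_two, Matrix.one_apply,
    hS.slashG_inv_symm hθ k]
  simp
  left; ring

theorem sprod_slashGrad (hS : IsConeSection G V U s₀ uf) (hθ : θ ∈ U) :
    sprod (slashG G (emb (fun _ => s₀) uf θ)) (slashGrad G (fun _ => s₀) uf uf θ)
      (slashGrad G (fun _ => s₀) uf uf θ) =
    codot (slashG G (emb (fun _ => s₀) uf θ)) (fun i => pd uf i θ) fun i => pd uf i θ := by
  have h := hS.sum_mul_slashGrad hθ
  calc _ = ∑ j, slashGrad G (fun _ => s₀) uf uf θ j * ∑ k,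
        G (emb (fun _ => s₀) uf θ) (ang j) (ang k) * slashGrad G (fun _ => s₀) uf uf θ k := by
        simp only [sprod, slashG_apply, Finset.mul_sum]
        exact Finset.sum_congr rfl fun _ _ => Finset.sum_congr rfl fun _ _ => by ring
    _ = _ := by
        simp only [h]
        simp only [slashGrad, codot, Finset.sum_mul]
        exact Finset.sum_congr rfl fun _ _ => Finset.sum_congr rfl fun _ _ => by ring

/-- With `e = 0` the denominator `D` is `2Ω² + √((2Ω²)²) = 4Ω²`, while `|e̲|² = 4Ω⁴|df̲|²`. -/
theorem ueps_eq (hS : IsConeSection G V U s₀ uf) (hθ : θ ∈ U) :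
    ueps G (fun _ => s₀) uf θ = -Om G (emb (fun _ => s₀) uf θ) ^ 2 *
      codot (slashG G (emb (fun _ => s₀) uf θ)) (fun i => pd uf i θ) fun i => pd uf i θ := by
  have hΩ := pow_pos (hS.metric.Om_pos (hS.mem θ hθ)) 2
  have h1 : sprod (slashG G (emb (fun _ => s₀) uf θ)) (ue G (fun _ => s₀) uf θ)
      (ue G (fun _ => s₀) uf θ) = 4 * (Om G (emb (fun _ => s₀) uf θ) ^ 2) ^ 2 *
      codot (slashG G (emb (fun _ => s₀) uf θ)) (fun i => pd uf i θ) fun i => pd uf i θ := by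
    rw [← hS.sprod_slashGrad hθ]
    simp only [sprod, hS.ue_eq hθ, Finset.mul_sum]
    exact Finset.sum_congr rfl fun _ _ => Finset.sum_congr rfl fun _ _ => by ring
  have h0 : ∀ (A : Matrix (Fin 2) (Fin 2) ℝ) Y, sprod A 0 Y = 0 := fun A Y => by simp [sprod]
  have h2 : epsDen G (fun _ => s₀) uf θ = 4 * Om G (emb (fun _ => s₀) uf θ) ^ 2 := by
    simp only [epsDen, e_eq_zero, h0, add_zero, zero_mul, sub_zero]
    rw [Real.sqrt_sq (by positivity)]; ring
  rw [ueps, h1, h2]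
  generalize Om G (emb (fun _ => s₀) uf θ) ^ 2 = W at *
  field_simp

theorem dotuL_zero (hS : IsConeSection G V U s₀ uf) (hθ : θ ∈ U) :
    dotuL G (fun _ => s₀) uf θ 0 = 1 := by
  simp [dotuL, hS.metric.uL_zero (hS.mem θ hθ), hS.metric.L_eq (hS.mem θ hθ)]

theorem dotuL_one (hS : IsConeSection G V U s₀ uf) (hθ : θ ∈ U) :
    dotuL G (fun _ => s₀) uf θ 1 = -Om G (emb (fun _ => s₀) uf θ) ^ 2 *
      codot (slashG G (emb (fun _ => s₀) uf θ)) (fun i => pd uf i θ) fun i => pd uf i θ := by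
  simp [dotuL, hS.metric.uL_one (hS.mem θ hθ), hS.metric.L_eq (hS.mem θ hθ), hS.ueps_eq hθ]

theorem dotuL_ang (hS : IsConeSection G V U s₀ uf) (hθ : θ ∈ U) (a : Fin 2) :
    dotuL G (fun _ => s₀) uf θ (ang a) = uL G (emb (fun _ => s₀) uf θ) (ang a) -
      2 * Om G (emb (fun _ => s₀) uf θ) ^ 2 * slashGrad G (fun _ => s₀) uf uf θ a := by
  simp only [dotuL, hS.metric.L_eq (hS.mem θ hθ), e_eq_zero, hS.ue_eq hθ]
  fin_cases a <;> simp [ang_ne_one] <;> ring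

/-- This is the normality `g(L̲̇, ∂̇_j) = 0` written in components, with the angular part isolated.
-/
theorem sum_mul_dotuL (hS : IsConeSection G V U s₀ uf) (hθ : θ ∈ U) (j : Fin 2) :
    ∑ a, G (emb (fun _ => s₀) uf θ) (ang j) (ang a) * dotuL G (fun _ => s₀) uf θ (ang a) =
      -(G (emb (fun _ => s₀) uf θ) 0 (ang j) +
        2 * (Om G (emb (fun _ => s₀) uf θ) ^ 2 * pd uf j θ)) := by
  rw [← hS.sum_mul_slashGrad hθ, hS.metric.zero_ang (hS.mem θ hθ)]
  simp only [hS.dotuL_ang hθ, Fin.sum_univ_two]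
  ring

theorem differentiableAt_dotuL_ang (hS : IsConeSection G V U s₀ uf) (hθ : θ ∈ U) (a : Fin 2) :
    DifferentiableAt ℝ (fun y => dotuL G (fun _ => s₀) uf y (ang a)) θ := by
  have hx := hS.mem θ hθ
  have h1 : (fun y => dotuL G (fun _ => s₀) uf y (ang a)) =ᶠ[𝓝 θ]
      fun y => uL G (emb (fun _ => s₀) uf y) (ang a) -
      2 * Om G (emb (fun _ => s₀) uf y) ^ 2 * slashGrad G (fun _ => s₀) uf uf y a := by
    filter_upwards [hS.isOpen.mem_nhds hθ] with y hy using hS.dotuL_ang hy a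
  have h2 : DifferentiableAt ℝ (fun y => slashGrad G (fun _ => s₀) uf uf y a) θ := by
    simp only [slashGrad]
    refine DifferentiableAt.fun_sum fun j _ => DifferentiableAt.mul ?_ (hS.differentiableAt_pd hθ j)
    refine differentiableAt_inv (A := fun y => slashG G (emb (fun _ => s₀) uf y))
      (fun k l => ?_) (hS.det_slashG θ hθ) a j
    simp only [slashG_apply]
    exact hS.differentiableAt_comp hθ (hS.metric.differentiableAt _ hx _ _)
  exact DifferentiableAt.congr_of_eventuallyEq
    ((hS.differentiableAt_comp hθ (hS.metric.differentiableAt_uL hx (ang a))).sub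
      (((hS.differentiableAt_comp hθ (hS.metric.differentiableAt_Om_sq hx)).const_mul 2).mul h2)) h1

/-- The derivative along `∂̇_i` of the normality relation `sum_mul_dotuL`. No derivative of the
inverse of `g̸` enters, and the second derivatives of `f̲` in the Hessian term of `χ̲̇` originate
here. -/
theorem sum_mul_pd_dotuL (hS : IsConeSection G V U s₀ uf) (hθ : θ ∈ U)
    {x : EuclideanSpace ℝ (Fin 4)} (hx : x = emb (fun _ => s₀) uf θ) (i j : Fin 2) :
    ∑ a, G x (ang j) (ang a) * pd (fun y => dotuL G (fun _ => s₀) uf y (ang a)) i θ =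
      -(pd (fun y => G y 0 (ang j)) (ang i) x + pd uf i θ * pd (fun y => G y 0 (ang j)) 1 x) -
      2 * ((pd (fun y => Om G y ^ 2) (ang i) x + pd uf i θ * pd (fun y => Om G y ^ 2) 1 x) *
        pd uf j θ + Om G x ^ 2 * pd (pd uf j) i θ) -
      ∑ a, (pd (fun y => G y (ang j) (ang a)) (ang i) x +
        pd uf i θ * pd (fun y => G y (ang j) (ang a)) 1 x) *
          dotuL G (fun _ => s₀) uf θ (ang a) := by
  subst hx
  have hx := hS.mem θ hθ
  have hd := hS.metric.differentiableAt _ hx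
  have hW := hS.metric.differentiableAt_Om_sq hx
  have hu := hS.differentiableAt hθ
  have hg : ∀ μ ν, DifferentiableAt ℝ (fun y => G (emb (fun _ => s₀) uf y) μ ν) θ :=
    fun μ ν => hS.differentiableAt_comp hθ (hd μ ν)
  have hw := hS.differentiableAt_comp hθ hW
  have hp := hS.differentiableAt_dotuL_ang hθ
  have key : pd (fun y => G (emb (fun _ => s₀) uf y) (ang j) (ang 0) *
        dotuL G (fun _ => s₀) uf y (ang 0) + G (emb (fun _ => s₀) uf y) (ang j) (ang 1) *
        dotuL G (fun _ => s₀) uf y (ang 1)) i θ =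
      pd (fun y => -(G (emb (fun _ => s₀) uf y) 0 (ang j) +
        2 * (Om G (emb (fun _ => s₀) uf y) ^ 2 * pd uf j y))) i θ := by
    refine pd_congr ?_ i
    filter_upwards [hS.isOpen.mem_nhds hθ] with y hy
    rw [← hS.sum_mul_dotuL hy, Fin.sum_univ_two]
  have hm := hw.fun_mul (hS.differentiableAt_pd hθ j)
  rw [pd_neg, pd_add (hg _ _) (hm.const_mul 2), pd_const_mul hm,
    pd_mul hw (hS.differentiableAt_pd hθ j),
    pd_add ((hg _ _).fun_mul (hp _)) ((hg _ _).fun_mul (hp _)), pd_mul (hg _ _) (hp _),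
    pd_mul (hg _ _) (hp _), pd_comp_emb hu (hd _ _), pd_comp_emb hu (hd _ _),
    pd_comp_emb hu (hd _ _), pd_comp_emb hu hW] at key
  simp only [Fin.sum_univ_two]
  linear_combination key

/-- Since `L̇ = L` and `g(L, ·) = 2Ω² ds`, only the `s`-component of `L̲̇` matters, and it equals
`1`. -/
theorem dotOm_sq (hS : IsConeSection G V U s₀ uf) (hθ : θ ∈ U) :
    dotOm G (fun _ => s₀) uf θ ^ 2 = Om G (emb (fun _ => s₀) uf θ) ^ 2 := by
  have hx := hS.mem θ hθ
  have h : sprod (G (emb (fun _ => s₀) uf θ)) (dotuL G (fun _ => s₀) uf θ)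
      (dotL G (fun _ => s₀) uf θ) = 2 * Om G (emb (fun _ => s₀) uf θ) ^ 2 := by
    rw [dotL_eq, hS.metric.L_eq hx]
    simp [sprod, Pi.single_apply, hS.metric.apply_one hx,
      hS.dotuL_zero hθ]
  rw [dotOm, h, Real.sq_sqrt (by positivity)]; ring

/-! ### Structure coefficients of the section -/

theorem sprod_covAlong (hS : IsConeSection G V U s₀ uf) (hθ : θ ∈ U) (i : Fin 2)
    (Z : EuclideanSpace ℝ (Fin 2) → Fin 4 → ℝ) (Y : Fin 4 → ℝ) :
    sprod (G (emb (fun _ => s₀) uf θ)) (covAlong G (fun _ => s₀) uf i Z θ) Y =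
      sprod (G (emb (fun _ => s₀) uf θ)) (fun μ => pd (fun y => Z y μ) i θ) Y +
        ∑ σ, Y σ * ∑ ν, dDot (fun _ => s₀) uf i θ ν * ∑ ρ, Z θ ρ *
          christoffelFst G σ ν ρ (emb (fun _ => s₀) uf θ) :=
  sprod_add_christoffel (hS.metric.det_ne_zero (hS.mem θ hθ))
    (hS.metric.isSymm _ (hS.mem θ hθ)) _ (dDot (fun _ => s₀) uf i θ) (Z θ) Y

/-- `Γ̸^k_{ij} f̲_k` in terms of the Christoffel symbols of the first kind. -/
theorem slashHess_eq (hS : IsConeSection G V U s₀ uf) (hθ : θ ∈ U) (i j : Fin 2) :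
    slashHess G (fun _ => s₀) uf uf θ i j = pd (pd uf j) i θ -
      ∑ k, slashGrad G (fun _ => s₀) uf uf θ k *
        christoffelFst G (ang k) (ang i) (ang j) (emb (fun _ => s₀) uf θ) := by
  have hd := hS.metric.differentiableAt _ (hS.mem θ hθ)
  have h : ∀ σ ν ρ : Fin 2, christoffelFst (fun y => slashG G (pt s₀ (uf θ) y)) σ ν ρ θ =
      christoffelFst G (ang σ) (ang ν) (ang ρ) (emb (fun _ => s₀) uf θ) := fun σ ν ρ => by
    simp only [christoffelFst, slashG_apply]
    rw [pd_comp_pt (hd _ _), pd_comp_pt (hd _ _), pd_comp_pt (hd _ _)]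
    rfl
  have hi : ∀ k l, (slashG G (pt s₀ (uf θ) θ))⁻¹ k l = (slashG G (pt s₀ (uf θ) θ))⁻¹ l k :=
    hS.slashG_inv_symm hθ
  simp only [slashHess, slashChristoffel, christoffel_eq, h, slashGrad, emb, Fin.sum_univ_two]
  rw [hi 1 0]
  ring

/-- As `L̇ = L` has constant components, only `½ ∂_s̲ G` contracted with `∂̇_i` and `∂̇_j` survives;
their `L`-parts drop out because the relevant entries of the `s̲`-row vanish identically. -/
theorem dotChi_eq (hS : IsConeSection G V U s₀ uf) (hθ : θ ∈ U) (i j : Fin 2) :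
    dotChi G (fun _ => s₀) uf θ i j = chi G (emb (fun _ => s₀) uf θ) i j := by
  have hx := hS.mem θ hθ
  have hL : ∀ μ, pd (fun y => dotL G (fun _ => s₀) uf y μ) i θ = 0 := fun μ => by
    refine pd_of_eventuallyEq_const (c := (Pi.single 1 1 : Fin 4 → ℝ) μ) ?_ i
    filter_upwards [hS.isOpen.mem_nhds hθ] with y hy
    rw [dotL_eq, hS.metric.L_eq (hS.mem y hy)]
  rw [hS.metric.chi_eq hx, dotChi, hS.sprod_covAlong hθ]
  simp only [hL]
  simp only [dotL_eq, hS.metric.L_eq hx]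
  simp [sprod, sum_fin_four, christoffelFst, hS.metric.pd_ang_one hx, hS.metric.pd_one_ang hx,
    hS.metric.pd_one_one hx, Pi.single_apply]
  rw [hS.metric.pd_comm hx]

theorem pd_dotuL_zero (hS : IsConeSection G V U s₀ uf) (hθ : θ ∈ U) (i : Fin 2) :
    pd (fun y => dotuL G (fun _ => s₀) uf y 0) i θ = 0 := by
  refine pd_of_eventuallyEq_const (c := 1) ?_ i
  filter_upwards [hS.isOpen.mem_nhds hθ] with y hy using hS.dotuL_zero hy

/-- Contraction with `L` sees only the constant `s`-component of `L̲̇`, so no derivative of `L̲̇`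
remains. The change from `η` comes from the angular part `-2Ω² ∇̸f̲`, which produces `χ(∇̸f̲)`. -/
theorem dotEta_eq (hS : IsConeSection G V U s₀ uf) (hθ : θ ∈ U) (i : Fin 2) :
    dotEta G (fun _ => s₀) uf θ i = eta G (emb (fun _ => s₀) uf θ) i +
      contr (chi G (emb (fun _ => s₀) uf θ)) (slashGrad G (fun _ => s₀) uf uf θ) i := by
  have hx := hS.mem θ hθ
  have hΩ := pow_pos (hS.metric.Om_pos hx) 2
  have h1 := hS.metric.eta_eq hx i
  have h2 : 4 * Om G (emb (fun _ => s₀) uf θ) ^ 2 * dotEta G (fun _ => s₀) uf θ i =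
      2 * sprod (G (emb (fun _ => s₀) uf θ))
        (covAlong G (fun _ => s₀) uf i (dotuL G (fun _ => s₀) uf) θ)
        (L G (emb (fun _ => s₀) uf θ)) := by
    rw [dotEta, dotL', IsDoubleNullMetric.sprod_smul_right, hS.dotOm_sq hθ, dotL_eq]
    generalize Om G (emb (fun _ => s₀) uf θ) ^ 2 = W at *
    field_simp; norm_num
  rw [hS.sprod_covAlong hθ, hS.metric.L_eq hx] at h2
  simp [sprod, sum_fin_four, christoffelFst, hS.metric.pd_one_ang hx, hS.metric.apply_one hx,
    Pi.single_apply, hS.dotuL_zero hθ, hS.metric.pd_one_zero hx,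
    hS.metric.pd_one_one hx, hS.metric.pd_zero_one hx, hS.metric.pd_ang_one hx,
    hS.pd_dotuL_zero hθ, hS.metric.pd_ang_zero hx, hS.dotuL_ang hθ] at h2
  simp only [contr, hS.metric.chi_eq hx]
  apply mul_left_cancel₀ (show 4 * Om G (emb (fun _ => s₀) uf θ) ^ 2 ≠ 0 by positivity)
  simp only [Fin.sum_univ_two] at h1 h2 ⊢
  linear_combination h2 - h1

theorem dotuChi_eq (hS : IsConeSection G V U s₀ uf) (hθ : θ ∈ U)
    {x : EuclideanSpace ℝ (Fin 4)} (hx' : x = emb (fun _ => s₀) uf θ) (i j : Fin 2) :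
    dotuChi G (fun _ => s₀) uf θ i j = uchi G x i j
      - Om G x ^ 2 * codot (slashG G x) (fun k => pd uf k θ) (fun k => pd uf k θ) * chi G x i j
      - 2 * Om G x ^ 2 * slashHess G (fun _ => s₀) uf uf θ i j
      - 4 * Om G x ^ 2 * symm2 (ueta G x) (fun k => pd uf k θ) i j
      - 4 * omega G x * Om G x ^ 2 * (pd uf i θ * pd uf j θ)
      + 4 * Om G x ^ 2 * symm2 (fun k => pd uf k θ)
          (contr (chi G x) (slashGrad G (fun _ => s₀) uf uf θ)) i j := by
  have hx : x ∈ V := hx' ▸ hS.mem θ hθ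
  have h1 := hS.sum_mul_pd_dotuL hθ hx' i j
  -- The formulas for `η̲` and `ω` are multiplied in advance by the derivatives of `f̲` accompanying
  -- them, so that the final identity is linear with numerical coefficients.
  have hui := congrArg (pd uf j θ * ·) (hS.metric.ueta_eq hx i)
  have huj := congrArg (pd uf i θ * ·) (hS.metric.ueta_eq hx j)
  have hc := hS.metric.uchi_eq hx i j
  have ho := congrArg (pd uf i θ * pd uf j θ * ·) (hS.metric.omega_eq hx)
  have h2 := hS.sprod_covAlong hθ i (dotuL G (fun _ => s₀) uf) (dDot (fun _ => s₀) uf j θ)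
  have ha : ∀ a, dotuL G (fun _ => s₀) uf θ (ang a) = uL G x (ang a) -
      2 * Om G x ^ 2 * slashGrad G (fun _ => s₀) uf uf θ a := hx' ▸ hS.dotuL_ang hθ
  have hb : dotuL G (fun _ => s₀) uf θ 1 = -Om G x ^ 2 *
      codot (slashG G x) (fun i => pd uf i θ) fun i => pd uf i θ := hx' ▸ hS.dotuL_one hθ
  rw [← dotuChi, ← hx'] at h2
  simp [sprod, sum_fin_four, christoffelFst, hS.metric.apply_one hx, hS.metric.one_apply hx,
    ang_ne_zero, hS.dotuL_zero hθ, hb, hS.metric.pd_one_zero hx,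
    hS.metric.pd_one_one hx, hS.metric.pd_zero_one hx, hS.metric.pd_ang_one hx,
    hS.metric.pd_one_ang hx, hS.pd_dotuL_zero hθ, hS.metric.pd_ang_zero hx] at h2
  rw [hS.slashHess_eq hθ, ← hx']
  -- Substituting `ha` splits `L̲̇^a`: the shift part accounts for `χ̲` and `η̲`, the gradient part
  -- for `χ(∇̸f̲)` and the Christoffel term of the Hessian. The norm `|df̲|²` stays unexpanded.
  simp only [symm2, contr, hS.metric.chi_eq hx, christoffelFst, Fin.sum_univ_two, ha]
    at h1 h2 hc hui huj ho ⊢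
  -- With concrete indices, the symmetry of `G` can be used to bring all off-diagonal angular
  -- entries and their derivatives to one orientation.
  fin_cases i <;> fin_cases j <;>
    simp only [Fin.zero_eta, Fin.mk_one] at h1 h2 hc hui huj ho ⊢ <;>
    simp only [hS.metric.pd_comm hx (ang 1) (ang 0),
      (hS.metric.isSymm x hx).apply (ang 0) (ang 1)] at h1 h2 hc hui huj ⊢ <;>
    linear_combination h2 + h1 - (1 / 2) * hc + (1 / 2) * hui + (1 / 2) * huj + 2 * ho

/-- Under the trace, the symmetry of the inverse of `g̸` and of `χ` collapses both symmetrised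
products. -/
theorem tr_dotuChi (hS : IsConeSection G V U s₀ uf) (hθ : θ ∈ U)
    {x : EuclideanSpace ℝ (Fin 4)} (hx : x = emb (fun _ => s₀) uf θ) :
    tr (dotSlashG G (fun _ => s₀) uf θ) (dotuChi G (fun _ => s₀) uf θ) =
      tr (slashG G x) (uchi G x)
      - 2 * Om G x ^ 2 * tr (slashG G x) (slashHess G (fun _ => s₀) uf uf θ)
      - Om G x ^ 2 * codot (slashG G x) (fun k => pd uf k θ) (fun k => pd uf k θ) *
          tr (slashG G x) (chi G x)
      - 4 * Om G x ^ 2 * codot (slashG G x) (ueta G x) (fun k => pd uf k θ)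
      - 4 * Om G x ^ 2 * omega G x *
          codot (slashG G x) (fun k => pd uf k θ) (fun k => pd uf k θ)
      + 4 * Om G x ^ 2 * ∑ i, ∑ j, chi G x i j * slashGrad G (fun _ => s₀) uf uf θ i *
          slashGrad G (fun _ => s₀) uf uf θ j := by
  have hs : (slashG G x)⁻¹ 1 0 = (slashG G x)⁻¹ 0 1 := hx ▸ hS.slashG_inv_symm hθ 1 0
  have hg : ∀ k, slashGrad G (fun _ => s₀) uf uf θ k = ∑ j, (slashG G x)⁻¹ k j * pd uf j θ :=
    fun k => by rw [hx]; rfl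
  have hc : chi G x 1 0 = chi G x 0 1 := by
    have hV : x ∈ V := hx ▸ hS.mem θ hθ
    rw [hS.metric.chi_eq hV, hS.metric.chi_eq hV, hS.metric.pd_comm hV]
  rw [dotSlashG_eq hS.metric (hS.mem θ hθ), ← hx]
  simp only [tr, hS.dotuChi_eq hθ hx, symm2, contr, hg]
  -- The norm `|df̲|²` is kept as a symbol; its expansion is needed only for the `ω` term, where the
  -- trace of `f̲_i f̲_j` must be recognised as that norm.
  generalize hN : codot (slashG G x) (fun k => pd uf k θ) (fun k => pd uf k θ) = N
  simp only [codot, Fin.sum_univ_two, hs, hc] at hN ⊢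
  linear_combination -4 * Om G x ^ 2 * omega G x * hN

end IsConeSection

end

end DoubleNull

theorem proposition4p2 {M : Type*} [TopologicalSpace M]
    [ChartedSpace (EuclideanSpace ℝ (Fin 4)) M] [IsManifold (𝓡 4) ∞ M]
    (g : DoubleNull.LorentzMetric M)
    (φ : OpenPartialHomeomorph M (EuclideanSpace ℝ (Fin 4)))
    (hφ : DoubleNull.IsDoubleNullCoordinates g φ)
    (S : Set M) (U : Set (EuclideanSpace ℝ (Fin 2))) (s₀ : ℝ)
    (f uf : EuclideanSpace ℝ (Fin 2) → ℝ) (hf : f = fun _ => s₀)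
    (hS : DoubleNull.IsParametrisedBy g φ S U f uf)
    (G : EuclideanSpace ℝ (Fin 4) → Matrix (Fin 4) (Fin 4) ℝ) (hG : G = g.inChart φ)
    (θ : EuclideanSpace ℝ (Fin 2)) (hθ : θ ∈ U)
    (x : EuclideanSpace ℝ (Fin 4)) (hx : x = DoubleNull.pt s₀ (uf θ) θ)
    (h : Matrix (Fin 2) (Fin 2) ℝ) (hh : h = DoubleNull.slashG G x)
    (Ω : ℝ) (hΩ : Ω = DoubleNull.Om G x)
    (duf : Fin 2 → ℝ) (hduf : duf = fun i => DoubleNull.pd uf i θ)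
    (guf : Fin 2 → ℝ) (hguf : guf = DoubleNull.slashGrad G f uf uf θ) :
    (∀ i j : Fin 2, DoubleNull.dotuChi G f uf θ i j =
      DoubleNull.uchi G x i j
        - Ω ^ 2 * DoubleNull.codot h duf duf * DoubleNull.chi G x i j
        - 2 * Ω ^ 2 * DoubleNull.slashHess G f uf uf θ i j
        - 4 * Ω ^ 2 * DoubleNull.symm2 (DoubleNull.ueta G x) duf i j
        - 4 * DoubleNull.omega G x * Ω ^ 2 * (duf i * duf j)
        + 4 * Ω ^ 2 * DoubleNull.symm2 duf (DoubleNull.contr (DoubleNull.chi G x) guf) i j) ∧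
    DoubleNull.tr (DoubleNull.dotSlashG G f uf θ) (DoubleNull.dotuChi G f uf θ) =
      DoubleNull.tr h (DoubleNull.uchi G x)
        - 2 * Ω ^ 2 * DoubleNull.tr h (DoubleNull.slashHess G f uf uf θ)
        - Ω ^ 2 * DoubleNull.codot h duf duf * DoubleNull.tr h (DoubleNull.chi G x)
        - 4 * Ω ^ 2 * DoubleNull.codot h (DoubleNull.ueta G x) duf
        - 4 * Ω ^ 2 * DoubleNull.omega G x * DoubleNull.codot h duf duf
        + 4 * Ω ^ 2 * ∑ i, ∑ j, DoubleNull.chi G x i j * guf i * guf j ∧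
    (∀ i j : Fin 2, DoubleNull.dotChi G f uf θ i j = DoubleNull.chi G x i j) ∧
    DoubleNull.tr (DoubleNull.dotSlashG G f uf θ) (DoubleNull.dotChi G f uf θ) =
      DoubleNull.tr h (DoubleNull.chi G x) ∧
    (∀ i : Fin 2, DoubleNull.dotEta G f uf θ i =
      DoubleNull.eta G x i + DoubleNull.contr (DoubleNull.chi G x) guf i) := by
  subst hf hG hx hh hΩ hduf hguf
  have hC : DoubleNull.IsConeSection (g.inChart φ) φ.target U s₀ uf :=
    { metric := hφ.isDoubleNullMetric
      isOpen := hS.isOpen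
      contDiffOn := hS.contDiff_uf
      mem := hS.mem_target
      det_slashG := fun y hy => by
        -- Positive definiteness of the intrinsic metric gives the invertibility of `g̸` that
        -- raising indices on `df̲` requires.
        have hpos := hS.spacelike y hy
        have hd := hpos.det_pos.ne'
        rwa [DoubleNull.dotSlashG_eq hφ.isDoubleNullMetric (hS.mem_target y hy)] at hd }
  have hchi : DoubleNull.dotChi (g.inChart φ) (fun _ => s₀) uf θ =
      DoubleNull.chi (g.inChart φ) (DoubleNull.emb (fun _ => s₀) uf θ) := by
    ext i j
    exact hC.dotChi_eq hθ i j
  refine ⟨hC.dotuChi_eq hθ rfl, hC.tr_dotuChi hθ rfl, hC.dotChi_eq hθ, ?_, hC.dotEta_eq hθ⟩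
  rw [DoubleNull.dotSlashG_eq hC.metric (hC.mem θ hθ), hchi]
  rfl
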